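/- Let $\mathcal{A}f(t)=-\tfrac12 f''(t)+\tfrac12 t^2 f(t)$, $\mathbb{R}_+=(0,\infty)$, $\mathbb{R}_-=(-\infty,0)$. In the complex Hilbert space $L_2(\mathbb{R}_\pm)$ let $A_\pm^{\min}f=\mathcal{A}f$ with domain $\mathcal{D}(A_\pm^{\min})=C_c^\infty(\mathbb{R}_\pm)$, and $A_\pm^{\max}f=\mathcal{A}f$ with domain $$\mathcal{D}(A_\pm^{\max})=\{f\in L_2(\mathbb{R}_\pm): f \text{ is differentiable},\ f,f' \text{ are locally absolutely continuous on } \mathbb{R}_\pm,\ \mathcal{A}f\in L_2(\mathbb{R}_\pm)\}.$$ For $\theta\in[0,\pi)$ let $A_{\pm,\theta}$ be the restriction of $A_\pm^{\max}$ to $$\mathcal{D}(A_{\pm,\theta})=\{f\in\mathcal{D}(A_\pm^{\max}): f(\pm0) \text{ and } f'(\pm0) \text{ exist and } \cos(\theta)\,f(\pm0)=\sin(\theta)\,f'(\pm0)\},$$ where $f(+0)=\lim_{t\to0^+}f(t)$ and $f(-0)=\lim_{t\to0^-}f(t)$, and similarly for $f'$. Then, for each choice of the sign, $A_\pm^{\min}$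 is closable, and every selfadjoint extension $B$ of $A_\pm^{\min}$ is a restriction of $A_\pm^{\max}$, is a one-dimensional extension of the closure $\overline{A_\pm^{\min}}$ (that is, $\overline{A_\pm^{\min}}\subseteq B$ and $\dim\mathcal{D}(B)/\mathcal{D}(\overline{A_\pm^{\min}})=1$), and is equal to $A_{\pm,\theta}$ for some $\theta\in[0,\pi)$. Conversely, for every $\theta\in[0,\pi)$ the operator $A_{\pm,\theta}$ is a selfadjoint extension of $A_\pm^{\min}$. -/

import Mathlib

open MeasureTheory Set Filter Topology TopologicalSpace
open scoped ContDiff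

namespace HalfLineOscillator

/-- The open half-line `ℝ₊ = (0, ∞)`. -/
def posHalfLine : Opens ℝ := ⟨Ioi 0, isOpen_Ioi⟩

/-- The open half-line `ℝ₋ = (-∞, 0)`. -/
def negHalfLine : Opens ℝ := ⟨Iio 0, isOpen_Iio⟩

/-- The complex Hilbert space `L₂(I)`. -/
abbrev L2 (I : Opens ℝ) : Type := Lp ℂ 2 (volume.restrict (I : Set ℝ))

/-- The differential expression `𝒜u = -½ u'' + ½ t² u`. -/
noncomputable def osc (u : ℝ → ℂ) (t : ℝ) : ℂ :=
  -(1 / 2) * deriv (deriv u) t + (1 / 2) * (t : ℂ) ^ 2 * u t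

/-- `u` is (locally) absolutely continuous in `I`: absolutely continuous on every compact
interval contained in `I`. -/
def LocAC (I : Opens ℝ) (u : ℝ → ℂ) : Prop :=
  ∀ a b : ℝ, uIcc a b ⊆ (I : Set ℝ) → AbsolutelyContinuousOnInterval u a b

theorem ac_congr {f g : ℝ → ℂ} {a b : ℝ} (h : EqOn f g (uIcc a b))
    (hf : AbsolutelyContinuousOnInterval f a b) : AbsolutelyContinuousOnInterval g a b := by
  rw [absolutelyContinuousOnInterval_iff] at hf ⊢
  intro ε hε
  obtain ⟨δ, hδ, H⟩ := hf ε hε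
  refine ⟨δ, hδ, fun E hE hs => ?_⟩
  have := H E hE hs
  rw [Finset.sum_congr rfl fun i hi => ?_]
  · exact this
  · rw [h (hE.1 i hi).1, h (hE.1 i hi).2]

theorem LocAC.congr {I : Opens ℝ} {u v : ℝ → ℂ} (hu : LocAC I u) (h : EqOn u v (I : Set ℝ)) :
    LocAC I v := fun a b hab => ac_congr (h.mono hab) (hu a b hab)

theorem LocAC.add {I : Opens ℝ} {u v : ℝ → ℂ} (hu : LocAC I u) (hv : LocAC I v) :
    LocAC I (u + v) := fun a b hab => (hu a b hab).add (hv a b hab)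

theorem LocAC.smul {I : Opens ℝ} {u : ℝ → ℂ} (c : ℂ) (hu : LocAC I u) :
    LocAC I (c • u) := fun a b hab => (hu a b hab).const_smul c

theorem LocAC.continuousOn {I : Opens ℝ} {u : ℝ → ℂ} (hu : LocAC I u) :
    ContinuousOn u (I : Set ℝ) := by
  intro x hx
  obtain ⟨ε, hε, hb⟩ := Metric.isOpen_iff.1 I.isOpen x hx
  have hsub : uIcc (x - ε / 2) (x + ε / 2) ⊆ (I : Set ℝ) := by
    refine Subset.trans ?_ hb
    rw [uIcc_of_le (by linarith), Real.ball_eq_Ioo]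
    intro y hy
    exact ⟨by linarith [hy.1], by linarith [hy.2]⟩
  refine ((hu _ _ hsub).continuousOn.continuousAt ?_).continuousWithinAt
  rw [uIcc_of_le (by linarith)]
  exact Icc_mem_nhds (by linarith) (by linarith)

theorem LocAC.ae_differentiableAt {I : Opens ℝ} {u : ℝ → ℂ} (hu : LocAC I u) :
    ∀ᵐ x ∂(volume.restrict (I : Set ℝ)), DifferentiableAt ℝ u x := by
  rw [ae_restrict_iff' I.isOpen.measurableSet, ae_iff]
  refine measure_null_of_locally_null _ fun x hx => ?_
  have hxI : x ∈ I := by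
    by_contra h
    exact hx fun hx' => absurd hx' h
  obtain ⟨ε, hε, hb⟩ := Metric.isOpen_iff.1 I.isOpen x hxI
  have hsub : uIcc (x - ε / 2) (x + ε / 2) ⊆ (I : Set ℝ) := by
    refine Subset.trans ?_ hb
    rw [uIcc_of_le (by linarith), Real.ball_eq_Ioo]
    intro y hy
    exact ⟨by linarith [hy.1], by linarith [hy.2]⟩
  refine ⟨_ ∩ uIcc (x - ε / 2) (x + ε / 2), inter_mem self_mem_nhdsWithin
    (mem_nhdsWithin_of_mem_nhds ?_), ?_⟩
  · rw [uIcc_of_le (by linarith)]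
    exact Icc_mem_nhds (by linarith) (by linarith)
  · have := (hu _ _ hsub).boundedVariationOn.ae_differentiableAt_of_mem_uIcc
    rw [ae_iff] at this
    refine measure_mono_null ?_ this
    rintro y ⟨hy, hy'⟩ h
    exact hy fun _ => h hy'

theorem eqOn_deriv_add {I : Opens ℝ} {u v : ℝ → ℂ}
    (hu : ∀ t ∈ I, DifferentiableAt ℝ u t) (hv : ∀ t ∈ I, DifferentiableAt ℝ v t) :
    EqOn (deriv u + deriv v) (deriv (u + v)) (I : Set ℝ) :=
  fun t ht => (deriv_add (hu t ht) (hv t ht)).symm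

theorem eqOn_deriv_smul {I : Opens ℝ} {u : ℝ → ℂ} (c : ℂ)
    (hu : ∀ t ∈ I, DifferentiableAt ℝ u t) :
    EqOn (c • deriv u) (deriv (c • u)) (I : Set ℝ) :=
  fun t ht => (deriv_const_smul c (hu t ht)).symm

/-- The functions `u : I → ℂ` with `u` and `u'` absolutely continuous (only the values of
`u : ℝ → ℂ` in the open set `I` matter). -/
def maxSpace (I : Opens ℝ) : Submodule ℂ (ℝ → ℂ) where
  carrier := {u | LocAC I u ∧ (∀ t ∈ I, DifferentiableAt ℝ u t) ∧ LocAC I (deriv u)}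
  zero_mem' := by
    have h0 : LocAC I 0 := fun a b _ => by
      have : ContDiffOn ℝ 1 (0 : ℝ → ℂ) (uIcc a b) := contDiffOn_const
      exact this.absolutelyContinuousOnInterval
    refine ⟨h0, fun t _ => differentiableAt_const (0 : ℂ), h0.congr fun t _ => ?_⟩
    simp
  add_mem' := fun {u v} hu hv => ⟨hu.1.add hv.1, fun t ht => (hu.2.1 t ht).add (hv.2.1 t ht),
    (hu.2.2.add hv.2.2).congr (eqOn_deriv_add hu.2.1 hv.2.1)⟩
  smul_mem' := fun c u hu => ⟨hu.1.smul c, fun t ht => (hu.2.1 t ht).const_smul c,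
    (hu.2.2.smul c).congr (eqOn_deriv_smul c hu.2.1)⟩

/-- The test functions `C_c^∞(I)`. -/
def testSpace (I : Opens ℝ) : Submodule ℂ (ℝ → ℂ) where
  carrier := {u | ContDiff ℝ ∞ u ∧ HasCompactSupport u ∧ tsupport u ⊆ (I : Set ℝ)}
  zero_mem' := ⟨contDiff_const, HasCompactSupport.zero, by simp [tsupport]⟩
  add_mem' := fun {u v} hu hv => ⟨hu.1.add hv.1, hu.2.1.add hv.2.1,
    (tsupport_add u v).trans (union_subset hu.2.2 hv.2.2)⟩
  smul_mem' := fun c u hu => ⟨hu.1.const_smul c, hu.2.1.smul_left (f := fun _ => c),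
    (tsupport_smul_subset_right (fun _ => c) u).trans hu.2.2⟩

/-- The functions `u` in `maxSpace I` whose one-sided limits `u(±0)`, `u'(±0)`
(limits as `t → 0` inside `I`) exist and satisfy `cos θ · u(±0) = sin θ · u'(±0)`. -/
def bcSpace (I : Opens ℝ) (θ : ℝ) : Submodule ℂ (ℝ → ℂ) where
  carrier := {u | u ∈ maxSpace I ∧ ∃ a b : ℂ,
    Tendsto u (𝓝[(I : Set ℝ)] 0) (𝓝 a) ∧ Tendsto (deriv u) (𝓝[(I : Set ℝ)] 0) (𝓝 b) ∧
    (Real.cos θ : ℂ) * a = (Real.sin θ : ℂ) * b}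
  zero_mem' := by
    refine ⟨zero_mem _, 0, 0, tendsto_const_nhds, ?_, by simp⟩
    have : deriv (0 : ℝ → ℂ) = fun _ => 0 := by ext; simp
    rw [this]
    exact tendsto_const_nhds
  add_mem' := by
    rintro u v ⟨hu, a, b, ha, hb, hab⟩ ⟨hv, a', b', ha', hb', hab'⟩
    refine ⟨add_mem hu hv, a + a', b + b', ha.add ha', ?_, by rw [mul_add, mul_add, hab, hab']⟩
    exact (hb.add hb').congr' (eventually_of_mem self_mem_nhdsWithin
      (eqOn_deriv_add hu.2.1 hv.2.1))
  smul_mem' := by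
    rintro c u ⟨hu, a, b, ha, hb, hab⟩
    refine ⟨Submodule.smul_mem _ c hu, c * a, c * b, ha.const_smul c, ?_, ?_⟩
    · exact (hb.const_smul c).congr' (eventually_of_mem self_mem_nhdsWithin
        (eqOn_deriv_smul c hu.2.1))
    · linear_combination c * hab

theorem testSpace_le (I : Opens ℝ) : testSpace I ≤ maxSpace I := by
  intro u hu
  have hd : ContDiff ℝ ∞ (deriv u) := (contDiff_infty_iff_deriv.1 hu.1).2
  refine ⟨fun a b _ => ?_, fun t _ => ?_, fun a b _ => ?_⟩
  · exact (hu.1.of_le (by simp)).contDiffOn.absolutelyContinuousOnInterval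
  · exact (hu.1.differentiable (by simp)) t
  · exact (hd.of_le (by simp)).contDiffOn.absolutelyContinuousOnInterval

theorem bcSpace_le (I : Opens ℝ) (θ : ℝ) : bcSpace I θ ≤ maxSpace I := fun _ hu => hu.1

theorem osc_add {I : Opens ℝ} {u v : ℝ → ℂ} (hu : u ∈ maxSpace I) (hv : v ∈ maxSpace I) :
    osc (u + v) =ᵐ[volume.restrict (I : Set ℝ)] osc u + osc v := by
  filter_upwards [hu.2.2.ae_differentiableAt, hv.2.2.ae_differentiableAt,
    ae_restrict_mem I.isOpen.measurableSet] with t h1 h2 ht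
  have : deriv (deriv (u + v)) t = deriv (deriv u) t + deriv (deriv v) t := by
    rw [← deriv_add h1 h2]
    exact ((eqOn_deriv_add hu.2.1 hv.2.1).symm.eventuallyEq_of_mem
      (I.isOpen.mem_nhds ht)).deriv_eq
  simp only [osc, this, Pi.add_apply]
  ring

theorem osc_smul {I : Opens ℝ} {u : ℝ → ℂ} (c : ℂ) (hu : u ∈ maxSpace I) :
    osc (c • u) =ᵐ[volume.restrict (I : Set ℝ)] c • osc u := by
  filter_upwards [hu.2.2.ae_differentiableAt,
    ae_restrict_mem I.isOpen.measurableSet] with t h1 ht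
  have : deriv (deriv (c • u)) t = c • deriv (deriv u) t := by
    rw [← deriv_const_smul c h1]
    exact ((eqOn_deriv_smul c hu.2.1).symm.eventuallyEq_of_mem
      (I.isOpen.mem_nhds ht)).deriv_eq
  simp only [osc, this, Pi.smul_apply, smul_eq_mul]
  ring

/-- The graph `{(u, 𝒜u) : u ∈ D, u ∈ L₂(I), 𝒜u ∈ L₂(I)}` in `L₂(I) × L₂(I)`. -/
def oscGraph (I : Opens ℝ) (D : Submodule ℂ (ℝ → ℂ)) (hD : D ≤ maxSpace I) :
    Submodule ℂ (L2 I × L2 I) where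
  carrier := {p | ∃ u ∈ D, p.1 =ᵐ[volume.restrict (I : Set ℝ)] u ∧
    p.2 =ᵐ[volume.restrict (I : Set ℝ)] osc u}
  zero_mem' := by
    refine ⟨0, zero_mem _, Lp.coeFn_zero _ _ _, ?_⟩
    have : osc 0 = 0 := by
      have h : deriv (0 : ℝ → ℂ) = 0 := by ext; simp
      ext t
      simp [osc, h]
    rw [this]
    exact Lp.coeFn_zero _ _ _
  add_mem' := by
    rintro p q ⟨u, hu, h1, h2⟩ ⟨v, hv, h3, h4⟩
    exact ⟨u + v, add_mem hu hv, (Lp.coeFn_add _ _).trans (h1.add h3),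
      (Lp.coeFn_add _ _).trans ((h2.add h4).trans (osc_add (hD hu) (hD hv)).symm)⟩
  smul_mem' := by
    rintro c p ⟨u, hu, h1, h2⟩
    exact ⟨c • u, Submodule.smul_mem _ c hu, (Lp.coeFn_smul _ _).trans (h1.const_smul c),
      (Lp.coeFn_smul _ _).trans ((h2.const_smul c).trans (osc_smul c (hD hu)).symm)⟩

/-- The set `oscGraph I D hD` is single-valued, hence the graph of an operator. -/
theorem oscGraph_snd_eq_zero (I : Opens ℝ) (D : Submodule ℂ (ℝ → ℂ)) (hD : D ≤ maxSpace I)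
    (p : L2 I × L2 I) (hp : p ∈ oscGraph I D hD) (h0 : p.1 = 0) : p.2 = 0 := by
  obtain ⟨u, hu, h1, h2⟩ := hp
  have hae : u =ᵐ[volume.restrict (I : Set ℝ)] fun _ => (0 : ℂ) :=
    h1.symm.trans (by rw [h0]; exact Lp.coeFn_zero _ _ _)
  have hEq : EqOn u (fun _ => (0 : ℂ)) (I : Set ℝ) :=
    Measure.eqOn_open_of_ae_eq hae I.isOpen (hD hu).1.continuousOn continuousOn_const
  have hd : EqOn (deriv u) (fun _ => (0 : ℂ)) (I : Set ℝ) := fun t ht => by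
    simpa using (hEq.eventuallyEq_of_mem (I.isOpen.mem_nhds ht)).deriv_eq
  have hdd : EqOn (deriv (deriv u)) (fun _ => (0 : ℂ)) (I : Set ℝ) := fun t ht => by
    simpa using (hd.eventuallyEq_of_mem (I.isOpen.mem_nhds ht)).deriv_eq
  refine (Lp.eq_zero_iff_ae_eq_zero).2 (h2.trans ?_)
  filter_upwards [ae_restrict_mem I.isOpen.measurableSet] with t ht
  simp [osc, hEq ht, hdd ht]

/-- The operator `f ↦ 𝒜f` in `L₂(I)` with domain `{f ∈ D : f ∈ L₂(I), 𝒜f ∈ L₂(I)}`. -/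
noncomputable def oscOp (I : Opens ℝ) (D : Submodule ℂ (ℝ → ℂ)) (hD : D ≤ maxSpace I) :
    L2 I →ₗ.[ℂ] L2 I :=
  (oscGraph I D hD).toLinearPMap

theorem oscOp_graph (I : Opens ℝ) (D : Submodule ℂ (ℝ → ℂ)) (hD : D ≤ maxSpace I) :
    (oscOp I D hD).graph = oscGraph I D hD :=
  Submodule.toLinearPMap_graph_eq _ (oscGraph_snd_eq_zero I D hD)

/-- The minimal operator: domain `C_c^∞(I)`. -/
noncomputable def oscMin (I : Opens ℝ) : L2 I →ₗ.[ℂ] L2 I :=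
  oscOp I (testSpace I) (testSpace_le I)

/-- The maximal operator: domain `{f ∈ L₂(I) : f, f' abs. cont., 𝒜f ∈ L₂(I)}`. -/
noncomputable def oscMax (I : Opens ℝ) : L2 I →ₗ.[ℂ] L2 I :=
  oscOp I (maxSpace I) le_rfl

/-- The restriction of the maximal operator by `cos θ · f(±0) = sin θ · f'(±0)`. -/
noncomputable def oscBC (I : Opens ℝ) (θ : ℝ) : L2 I →ₗ.[ℂ] L2 I :=
  oscOp I (bcSpace I θ) (bcSpace_le I θ)

/-- Every test function belongs to the domain of the minimal operator: `𝒜u ∈ L₂(I)` is automatic. -/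
theorem exists_mem_oscMin_graph (I : Opens ℝ) (u : ℝ → ℂ) (hu : u ∈ testSpace I) :
    ∃ p ∈ (oscMin I).graph, p.1 =ᵐ[volume.restrict (I : Set ℝ)] u ∧
      p.2 =ᵐ[volume.restrict (I : Set ℝ)] osc u := by
  have hd : ContDiff ℝ ∞ (deriv u) := (contDiff_infty_iff_deriv.1 hu.1).2
  have hdd : Continuous (deriv (deriv u)) := (contDiff_infty_iff_deriv.1 hd).2.continuous
  have hc : Continuous u := hu.1.continuous
  have hu2 : MemLp u 2 (volume.restrict (I : Set ℝ)) :=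
    (hc.memLp_of_hasCompactSupport hu.2.1).restrict _
  have ho : MemLp (osc u) 2 (volume.restrict (I : Set ℝ)) := by
    refine (Continuous.memLp_of_hasCompactSupport ?_ ?_).restrict _
    · unfold osc
      fun_prop
    · exact (hu.2.1.deriv.deriv.mul_left (f := fun _ => -(1 / 2 : ℂ))).add
        (hu.2.1.mul_left (f := fun t : ℝ => (1 / 2 : ℂ) * (t : ℂ) ^ 2))
  refine ⟨(hu2.toLp u, ho.toLp (osc u)), ?_, hu2.coeFn_toLp, ho.coeFn_toLp⟩
  rw [oscMin, oscOp_graph]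
  exact ⟨u, hu, hu2.coeFn_toLp, ho.coeFn_toLp⟩

end HalfLineOscillator

/-! Green's identity reduces the theorem to linear algebra in ℂ². The adjoint of the minimal
operator is the maximal one (`adjoint_oscMin`): a pair (x, y) in the adjoint graph is a weak
solution of 𝒜x = y, and du Bois-Reymond's lemma turns x into a genuine solution
(`exists_isAC2_of_weak`). On the maximal domain u'' = t²u - 2𝒜u is integrable up to 0, so u and u'
have limits there, and a cut-off affine function realizes any prescribed pair of limits.

The end at infinity contributes nothing. The potential t² is nonnegative and can be dropped from an
energy estimate, which shows that u' is square integrable near infinity (`memLp_deriv`); the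
Wronskian of two maximal functions is then integrable and convergent, so it tends to 0. Hence ⟪𝒜x,
y⟫ - ⟪x, 𝒜y⟫ is a fixed nonzero multiple of a̅d - b̅c, where (a, b) and (c, d) are the boundary
values of x and y (`exists_isBoundaryMap`).

For a boundary map β of this kind the domain of the closure is ker β, and passing to the adjoint of
an intermediate operator means passing to the annihilator of its boundary values under the
nondegenerate form a̅d - b̅c. Selfadjoint extensions therefore correspond to subspaces of ℂ² equal
to their own annihilator. These are exactly the lines spanned by (sin θ, cos θ), which gives the
classification and the codimension one. -/

namespace HalfLineOscillator

/-! ### Selfadjoint extensions from an abstract Green identity -/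

section BoundaryMap

open ComplexConjugate

variable {H : Type*} [NormedAddCommGroup H] [InnerProductSpace ℂ H]

local notation "⟪" x ", " y "⟫" => inner ℂ x y

theorem closure_le_of_isClosed {T S : H →ₗ.[ℂ] H} (hS : S.IsClosed) (h : T ≤ S) :
    T.closure ≤ S := by
  have hT : T.IsClosable := hS.isClosable.leIsClosable h
  rw [← LinearPMap.le_graph_iff, ← hT.graph_closure_eq_closure_graph]
  exact Submodule.topologicalClosure_minimal _ (LinearPMap.le_graph_of_le h) hS

variable [CompleteSpace H]

/-- A larger operator has a smaller adjoint. -/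
theorem adjoint_antitone {T S : H →ₗ.[ℂ] H} (hT : Dense (T.domain : Set H)) (h : T ≤ S) :
    S.adjoint ≤ T.adjoint := by
  have hS : Dense (S.domain : Set H) := hT.mono h.1
  refine LinearPMap.IsFormalAdjoint.le_adjoint hT fun x y => ?_
  rw [LinearPMap.apply_comp_inclusion h x]
  exact (LinearPMap.adjoint_isFormalAdjoint hS).symm (Submodule.inclusion h.1 x) y

/-- A densely defined symmetric operator `T` with deficiency indices `(1, 1)`, witnessed by
boundary values `β : D(T†) → ℂ²` that satisfy an abstract Green identity. -/
structure IsBoundaryMap (T : H →ₗ.[ℂ] H) (β : T.adjoint.domain →ₗ[ℂ] ℂ × ℂ) (k : ℂ) : Prop where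
  dense : Dense (T.domain : Set H)
  le_adjoint : T ≤ T.adjoint
  surjective : Function.Surjective β
  ne_zero : k ≠ 0
  green : ∀ x y : T.adjoint.domain, ⟪T.adjoint x, (y : H)⟫ - ⟪(x : H), T.adjoint y⟫ =
    k * (conj (β x).1 * (β y).2 - conj (β x).2 * (β y).1)

theorem isClosable_of_le_adjoint {T : H →ₗ.[ℂ] H} (hT : Dense (T.domain : Set H))
    (h : T ≤ T.adjoint) : T.IsClosable :=
  (LinearPMap.adjoint_isClosed hT).isClosable.leIsClosable h

/-- A vector annihilated by the graph of the adjoint belongs to the graph of the closure. -/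
theorem mem_closure_graph {T : H →ₗ.[ℂ] H} (hT : Dense (T.domain : Set H))
    (h : T ≤ T.adjoint) {y z : H} (hyz : ∀ x : T.adjoint.domain, ⟪T.adjoint x, y⟫ = ⟪(x : H), z⟫) :
    (y, z) ∈ T.closure.graph := by
  rw [← (isClosable_of_le_adjoint hT h).graph_closure_eq_closure_graph]
  -- `H × H` carries the sup norm; its ℓ² version has the same topology and an inner product, so the
  -- closure becomes a double orthogonal complement.
  set e := (WithLp.prodContinuousLinearEquiv 2 ℂ H H)
  set K : Submodule ℂ (WithLp 2 (H × H)) := T.graph.comap e.toLinearEquiv.toLinearMap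
  have key : WithLp.toLp 2 (y, z) ∈ K.topologicalClosure := by
    rw [← Submodule.orthogonal_orthogonal_eq_closure, Submodule.mem_orthogonal]
    intro w hw
    rw [Submodule.mem_orthogonal] at hw
    -- Orthogonality of `w` to the graph says precisely that `w.snd` lies in the adjoint domain with
    -- image `-w.fst`.
    have hw' : ∀ x : T.domain, ⟪-w.fst, (x : H)⟫ = ⟪w.snd, T x⟫ := fun x => by
      have := hw (WithLp.toLp 2 ((x : H), T x)) (by
        change ((x : H), T x) ∈ T.graph
        exact T.mem_graph x)
      have h' : ⟪w.fst, (x : H)⟫ + ⟪w.snd, T x⟫ = 0 := by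
        rw [WithLp.prod_inner_apply] at this
        rw [← inner_conj_symm, ← inner_conj_symm w.snd, ← map_add]
        exact (map_eq_zero _).2 this
      rw [inner_neg_left]
      linear_combination -h'
    have hmem : w.snd ∈ T.adjoint.domain :=
      LinearPMap.mem_adjoint_domain_of_exists _ ⟨-w.fst, hw'⟩
    have hval : T.adjoint ⟨w.snd, hmem⟩ = -w.fst := LinearPMap.adjoint_apply_eq hT _ hw'
    have := hyz ⟨w.snd, hmem⟩
    rw [hval, inner_neg_left] at this
    rw [WithLp.prod_inner_apply]
    change ⟪w.fst, y⟫ + ⟪w.snd, z⟫ = 0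
    linear_combination -this
  have := (map_mem_closure e.continuous key (t := (T.graph : Set (H × H))) fun a ha => ha)
  exact this

namespace IsBoundaryMap

variable {T : H →ₗ.[ℂ] H} {β : T.adjoint.domain →ₗ[ℂ] ℂ × ℂ} {k : ℂ}

theorem green_eq_zero_iff (hβ : IsBoundaryMap T β k) (x y : T.adjoint.domain) :
    ⟪T.adjoint x, (y : H)⟫ = ⟪(x : H), T.adjoint y⟫ ↔
      conj (β x).1 * (β y).2 = conj (β x).2 * (β y).1 := by
  rw [← sub_eq_zero, hβ.green, mul_eq_zero, or_iff_right hβ.ne_zero, sub_eq_zero]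

/-- The adjoint of an intermediate operator in terms of boundary values. -/
theorem mem_adjoint_domain_iff (hβ : IsBoundaryMap T β k) {S : H →ₗ.[ℂ] H} (h1 : T ≤ S)
    (h2 : S ≤ T.adjoint) (y : T.adjoint.domain) : (y : H) ∈ S.adjoint.domain ↔
      ∀ x : T.adjoint.domain, (x : H) ∈ S.domain →
        conj (β x).1 * (β y).2 = conj (β x).2 * (β y).1 := by
  have hS : Dense (S.domain : Set H) := hβ.dense.mono h1.1
  constructor
  · intro hy x hx
    rw [← hβ.green_eq_zero_iff]
    have e1 : T.adjoint x = S ⟨x, hx⟩ := (h2.2 (x := ⟨x, hx⟩) (y := x) rfl).symm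
    have e2 : T.adjoint y = S.adjoint ⟨y, hy⟩ :=
      ((adjoint_antitone hβ.dense h1).2 (x := ⟨y, hy⟩) (y := y) rfl).symm
    rw [e1, e2]
    exact (LinearPMap.adjoint_isFormalAdjoint hS).symm ⟨x, hx⟩ ⟨y, hy⟩
  · intro h
    refine LinearPMap.mem_adjoint_domain_of_exists _ ⟨T.adjoint y, fun x => ?_⟩
    have e1 : T.adjoint ⟨x, h2.1 x.2⟩ = S x := (h2.2 (x := x) (y := ⟨x, h2.1 x.2⟩) rfl).symm
    have := (hβ.green_eq_zero_iff ⟨x, h2.1 x.2⟩ y).2 (h _ x.2)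
    rw [← inner_conj_symm, ← inner_conj_symm (y : H), ← e1, this]

/-- The domain of the closure consists of the vectors with vanishing boundary values. -/
theorem mem_closure_domain_iff (hβ : IsBoundaryMap T β k) (y : T.adjoint.domain) :
    (y : H) ∈ T.closure.domain ↔ β y = 0 := by
  have hcl : T.closure ≤ T.adjoint :=
    closure_le_of_isClosed (LinearPMap.adjoint_isClosed hβ.dense) hβ.le_adjoint
  constructor
  · intro hy
    -- The adjoint relation is a closed condition on pairs, so it extends from the graph of `T` to
    -- that of its closure; the boundary form of `y` with every `x` then vanishes.
    have key : ∀ x : T.adjoint.domain, conj (β y).1 * (β x).2 = conj (β y).2 * (β x).1 := by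
      intro x
      have hx : (x : H) ∈ T.closure.adjoint.domain := by
        have hmem : (y : H) ∈ T.closure.domain := hy
        refine LinearPMap.mem_adjoint_domain_of_exists _ ⟨T.adjoint x, fun z => ?_⟩
        have hz : ((z : H), T.closure z) ∈ closure (T.graph : Set (H × H)) := by
          have := T.closure.mem_graph z
          rw [← (isClosable_of_le_adjoint hβ.dense
            hβ.le_adjoint).graph_closure_eq_closure_graph] at this
          exact this
        have hclosed : IsClosed {p : H × H | ⟪T.adjoint x, p.1⟫ = ⟪(x : H), p.2⟫} :=
          isClosed_eq (by fun_prop) (by fun_prop)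
        refine closure_minimal (fun p hp => ?_) hclosed hz
        obtain ⟨w, hw1, hw2⟩ := T.mem_graph_iff.1 hp
        change ⟪T.adjoint x, p.1⟫ = ⟪(x : H), p.2⟫
        rw [← hw1, ← hw2]
        exact LinearPMap.adjoint_isFormalAdjoint hβ.dense x w
      exact (hβ.mem_adjoint_domain_iff (LinearPMap.le_closure T) hcl x).1 hx y hy
    obtain ⟨x, hx⟩ := hβ.surjective (0, 1)
    obtain ⟨x', hx'⟩ := hβ.surjective (1, 0)
    have h1 := key x
    have h2 := key x'
    rw [hx] at h1
    rw [hx'] at h2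
    simp only [mul_one, mul_zero, map_eq_zero] at h1 h2
    have h3 : (β y).2 = 0 := by simpa using h2.symm
    exact Prod.ext h1 h3
  · intro hy
    refine LinearPMap.mem_domain_of_mem_graph (mem_closure_graph hβ.dense hβ.le_adjoint
      (z := T.adjoint y) fun x => ?_)
    rw [hβ.green_eq_zero_iff, hy]
    simp

/-- A nonzero vector `(a, b) ∈ ℂ²` with `a̅ b` real is a multiple of some `(sin θ, cos θ)`. -/
theorem exists_angle {a b : ℂ} (hab : conj a * b = conj b * a) (hne : (a, b) ≠ 0) :
    ∃ θ ∈ Ico (0 : ℝ) Real.pi, ∃ c : ℂ, c ≠ 0 ∧ a = c * (Real.sin θ : ℂ) ∧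
      b = c * (Real.cos θ : ℂ) := by
  -- If `a ≠ 0`, the hypothesis says that `b / a` is real, so the vector is a complex multiple of a
  -- real one.
  obtain ⟨c, x, y, hc, ha, hb⟩ : ∃ (c : ℂ) (x y : ℝ), c ≠ 0 ∧ a = c * x ∧ b = c * y := by
    by_cases h : a = 0
    · exact ⟨b, 0, 1, fun hb => hne (by simp [h, hb]), by simp [h], by simp⟩
    · have him : (b / a).im = 0 := by
        rw [← Complex.conj_eq_iff_im, map_div₀,
          div_eq_div_iff (by simpa using h) h]
        linear_combination -hab
      refine ⟨a, 1, (b / a).re, h, by simp, ?_⟩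
      have : ((b / a).re : ℂ) = b / a := Complex.ext (by simp) (by simp [him])
      rw [this, mul_div_cancel₀ _ h]
  -- The polar angle of `y + ix` has sine proportional to `x` and cosine to `y`. A shift by π,
  -- absorbed into the sign of `c`, moves it from (-π, π] to [0, π).
  set z : ℂ := ⟨y, x⟩ with hz
  have hz0 : z ≠ 0 := by
    intro h
    rw [hz, Complex.ext_iff] at h
    simp only [Complex.zero_re, Complex.zero_im] at h
    exact hne (by simp [ha, hb, h.1, h.2])
  have hn : ((‖z‖ : ℝ) : ℂ) ≠ 0 := by simpa using hz0
  have hx : (x : ℂ) = (‖z‖ : ℝ) * (Real.sin z.arg : ℝ) := by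
    rw [← Complex.ofReal_mul, Complex.norm_mul_sin_arg]
  have hy : (y : ℂ) = (‖z‖ : ℝ) * (Real.cos z.arg : ℝ) := by
    rw [← Complex.ofReal_mul, Complex.norm_mul_cos_arg]
  have h1 := Complex.neg_pi_lt_arg z
  have h2 := Complex.arg_le_pi z
  by_cases hneg : z.arg < 0
  · refine ⟨z.arg + Real.pi, ⟨by linarith, by linarith⟩, -(c * (‖z‖ : ℝ)),
      neg_ne_zero.2 (mul_ne_zero hc hn), ?_, ?_⟩
    · rw [ha, hx, Real.sin_add_pi]; push_cast; ring
    · rw [hb, hy, Real.cos_add_pi]; push_cast; ring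
  · rcases h2.lt_or_eq with h2 | h2
    · exact ⟨z.arg, ⟨not_lt.1 hneg, h2⟩, c * (‖z‖ : ℝ), mul_ne_zero hc hn,
        by rw [ha, hx]; ring, by rw [hb, hy]; ring⟩
    · refine ⟨0, ⟨le_rfl, Real.pi_pos⟩, -(c * (‖z‖ : ℝ)), neg_ne_zero.2 (mul_ne_zero hc hn), ?_, ?_⟩
      · rw [ha, hx, h2]; simp
      · rw [hb, hy, h2]; simp

theorem sin_cos_ne_zero (θ : ℝ) : (((Real.sin θ : ℝ) : ℂ), ((Real.cos θ : ℝ) : ℂ)) ≠ 0 := by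
  intro h
  rw [Prod.mk_eq_zero, Complex.ofReal_eq_zero, Complex.ofReal_eq_zero] at h
  have := Real.sin_sq_add_cos_sq θ
  rw [h.1, h.2] at this
  norm_num at this

/-- The line `cos θ · a = sin θ · b` in `ℂ²` is spanned by `(sin θ, cos θ)`. -/
theorem eq_smul_of_cos_mul_eq {θ : ℝ} {p : ℂ × ℂ}
    (h : (Real.cos θ : ℂ) * p.1 = (Real.sin θ : ℂ) * p.2) :
    p = ((Real.sin θ : ℂ) * p.1 + (Real.cos θ : ℂ) * p.2) •
      (((Real.sin θ : ℝ) : ℂ), ((Real.cos θ : ℝ) : ℂ)) := by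
  have hsc : (Real.sin θ : ℂ) ^ 2 + (Real.cos θ : ℂ) ^ 2 = 1 := by
    exact_mod_cast Real.sin_sq_add_cos_sq θ
  refine Prod.ext ?_ ?_
  · simp only [Prod.smul_mk, smul_eq_mul]
    linear_combination (-p.1) * hsc + (Real.cos θ : ℂ) * h
  · simp only [Prod.smul_mk, smul_eq_mul]
    linear_combination (-p.2) * hsc - (Real.sin θ : ℂ) * h

/-- `S` is the restriction of `T†` by the boundary condition `cos θ · β₁ = sin θ · β₂`. -/
structure IsRestriction (β : T.adjoint.domain →ₗ[ℂ] ℂ × ℂ) (S : H →ₗ.[ℂ] H) (θ : ℝ) : Prop where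
  le : S ≤ T.adjoint
  mem_iff : ∀ x : T.adjoint.domain, (x : H) ∈ S.domain ↔
    (Real.cos θ : ℂ) * (β x).1 = (Real.sin θ : ℂ) * (β x).2

theorem IsRestriction.eq {S S' : H →ₗ.[ℂ] H} {θ : ℝ} (h : IsRestriction β S θ)
    (h' : IsRestriction β S' θ) : S = S' := by
  have key : ∀ {S S' : H →ₗ.[ℂ] H}, IsRestriction β S θ → IsRestriction β S' θ → S ≤ S' := by
    intro S S' h h'
    refine ⟨fun x hx => (h'.mem_iff ⟨x, h.le.1 hx⟩).2 ((h.mem_iff ⟨x, h.le.1 hx⟩).1 hx), ?_⟩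
    intro x y hxy
    rw [h.le.2 (x := x) (y := ⟨x, h.le.1 x.2⟩) rfl, h'.le.2 (x := y) (y := ⟨x, h.le.1 x.2⟩) hxy.symm]
  exact le_antisymm (key h h') (key h' h)

theorem le_isRestriction (hβ : IsBoundaryMap T β k) {S : H →ₗ.[ℂ] H} {θ : ℝ}
    (h : IsRestriction β S θ) : T ≤ S := by
  have hdom : T.domain ≤ S.domain := fun x hx => by
    rw [h.mem_iff ⟨x, hβ.le_adjoint.1 hx⟩, (hβ.mem_closure_domain_iff _).1
      ((LinearPMap.le_closure T).1 hx)]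
    simp
  refine ⟨hdom, fun x y hxy => ?_⟩
  rw [hβ.le_adjoint.2 (x := x) (y := ⟨x, hβ.le_adjoint.1 x.2⟩) rfl,
    h.le.2 (x := y) (y := ⟨x, hβ.le_adjoint.1 x.2⟩) hxy.symm]

/-- The line spanned by the real vector (sin θ, cos θ) is its own annihilator under the boundary
form, so the adjoint of `S` obeys the same boundary condition as `S`. -/
theorem isSelfAdjoint_of_isRestriction (hβ : IsBoundaryMap T β k) {S : H →ₗ.[ℂ] H} {θ : ℝ}
    (h : IsRestriction β S θ) : IsSelfAdjoint S := by
  have hTS := hβ.le_isRestriction h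
  rw [LinearPMap.isSelfAdjoint_def]
  refine IsRestriction.eq (β := β) (θ := θ) ⟨adjoint_antitone hβ.dense hTS, fun y => ?_⟩ h
  rw [hβ.mem_adjoint_domain_iff hTS h.le]
  constructor
  · intro hy
    obtain ⟨x, hx⟩ := hβ.surjective ((Real.sin θ : ℂ), (Real.cos θ : ℂ))
    have := hy x ((h.mem_iff x).2 (by rw [hx]; ring))
    rw [hx] at this
    simp only [Complex.conj_ofReal] at this
    exact this.symm
  · intro hy x hx
    rw [eq_smul_of_cos_mul_eq ((h.mem_iff x).1 hx)]
    simp only [Prod.smul_mk, smul_eq_mul, map_mul, Complex.conj_ofReal]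
    linear_combination -conj ((Real.sin θ : ℂ) * (β x).1 + (Real.cos θ : ℂ) * (β x).2) * hy

/-- Selfadjointness makes the boundary values of `B` equal to their own annihilator. One nonzero
isotropic vector among them fixes the angle, and isotropy against it confines all others to its
line. -/
theorem isRestriction_of_isSelfAdjoint (hβ : IsBoundaryMap T β k) {B : H →ₗ.[ℂ] H} (hTB : T ≤ B)
    (hB : IsSelfAdjoint B) : ∃ θ ∈ Ico (0 : ℝ) Real.pi, IsRestriction β B θ := by
  have hadj : B.adjoint = B := hB
  have hBM : B ≤ T.adjoint := by
    have := adjoint_antitone hβ.dense hTB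
    rwa [hadj] at this
  have hmem : ∀ y : T.adjoint.domain, (y : H) ∈ B.domain ↔ ∀ x : T.adjoint.domain,
      (x : H) ∈ B.domain → conj (β x).1 * (β y).2 = conj (β x).2 * (β y).1 := fun y => by
    rw [← hβ.mem_adjoint_domain_iff hTB hBM, hadj]
  obtain ⟨x, hxB, hx0⟩ : ∃ x : T.adjoint.domain, (x : H) ∈ B.domain ∧ β x ≠ 0 := by
    by_contra! hcon
    obtain ⟨x, hx⟩ := hβ.surjective (1, 0)
    have := hcon x ((hmem x).2 fun z hz => by rw [hcon z hz]; simp)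
    rw [hx] at this
    simp at this
  obtain ⟨θ, hθ, c, hc, ha, hb⟩ := exists_angle ((hmem x).1 hxB x hxB) hx0
  have hc' : conj c ≠ 0 := by simpa using hc
  refine ⟨θ, hθ, hBM, fun y => ⟨fun hy => ?_, fun hy => (hmem y).2 fun z hz => ?_⟩⟩
  · have := (hmem y).1 hy x hxB
    rw [ha, hb] at this
    simp only [map_mul, Complex.conj_ofReal] at this
    refine mul_left_cancel₀ hc' ?_
    linear_combination -this
  · have hz' := (hmem z).1 hz x hxB
    rw [ha, hb] at hz'
    simp only [map_mul, Complex.conj_ofReal] at hz'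
    have hz'' : (Real.cos θ : ℂ) * (β z).1 = (Real.sin θ : ℂ) * (β z).2 := by
      refine mul_left_cancel₀ hc' ?_
      linear_combination -hz'
    rw [eq_smul_of_cos_mul_eq hz'']
    simp only [Prod.smul_mk, smul_eq_mul, map_mul, Complex.conj_ofReal]
    linear_combination -conj ((Real.sin θ : ℂ) * (β z).1 + (Real.cos θ : ℂ) * (β z).2) * hy

/-- Restricted to the domain of `S`, the boundary map has the domain of the closure as kernel and
the line of (sin θ, cos θ) as image. -/
theorem finrank_quotient_closure (hβ : IsBoundaryMap T β k) {S : H →ₗ.[ℂ] H} {θ : ℝ}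
    (h : IsRestriction β S θ) :
    Module.finrank ℂ (S.domain ⧸ T.closure.domain.submoduleOf S.domain) = 1 := by
  set f : S.domain →ₗ[ℂ] ℂ × ℂ := β ∘ₗ Submodule.inclusion h.le.1 with hf
  have hker : T.closure.domain.submoduleOf S.domain = LinearMap.ker f := by
    ext x
    rw [LinearMap.mem_ker]
    exact hβ.mem_closure_domain_iff (Submodule.inclusion h.le.1 x)
  have hrange : LinearMap.range f =
      Submodule.span ℂ {(((Real.sin θ : ℝ) : ℂ), ((Real.cos θ : ℝ) : ℂ))} := by
    ext p
    rw [LinearMap.mem_range, Submodule.mem_span_singleton]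
    constructor
    · rintro ⟨x, rfl⟩
      exact ⟨_, (eq_smul_of_cos_mul_eq
        ((h.mem_iff (Submodule.inclusion h.le.1 x)).1 x.2)).symm⟩
    · rintro ⟨c, rfl⟩
      obtain ⟨x, hx⟩ := hβ.surjective (c • ((Real.sin θ : ℂ), (Real.cos θ : ℂ)))
      exact ⟨⟨x, (h.mem_iff x).2 (by rw [hx]; simp; ring)⟩, hx⟩
  rw [hker, f.quotKerEquivRange.finrank_eq, hrange, finrank_span_singleton (sin_cos_ne_zero θ)]

end IsBoundaryMap

end BoundaryMap

end HalfLineOscillator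

/-! ### Calculus of functions with absolutely continuous derivative -/

namespace HalfLineOscillator

open ComplexConjugate

/-- The primitive of an integrable complex function is absolutely continuous. -/
theorem absolutelyContinuousOnInterval_primitive {g : ℝ → ℂ} {a b c : ℝ}
    (hg : IntervalIntegrable g volume a b) (hc : c ∈ uIcc a b) :
    AbsolutelyContinuousOnInterval (fun x => ∫ t in c..x, g t) a b := by
  have hconst : ∀ z : ℂ, AbsolutelyContinuousOnInterval (fun _ : ℝ => z) a b := fun z =>
    (contDiff_const (n := 1)).contDiffOn.absolutelyContinuousOnInterval
  have hre : IntervalIntegrable (fun t => (g t).re) volume a b := ⟨hg.1.re, hg.2.re⟩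
  have him : IntervalIntegrable (fun t => (g t).im) volume a b := ⟨hg.1.im, hg.2.im⟩
  -- Real and imaginary parts are treated separately and recombined with the constants 1 and i.
  have h := ((hre.absolutelyContinuousOnInterval_intervalIntegral hc).smul (hconst 1)).add
    ((him.absolutelyContinuousOnInterval_intervalIntegral hc).smul (hconst Complex.I))
  refine ac_congr (fun x hx => ?_) h
  have hgx : IntervalIntegrable g volume c x := hg.mono_set (uIcc_subset_uIcc hc hx)
  have h1 : (∫ t in c..x, g t).re = ∫ t in c..x, (g t).re :=
    (Complex.reCLM.intervalIntegral_comp_comm hgx).symm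
  have h2 : (∫ t in c..x, g t).im = ∫ t in c..x, (g t).im :=
    (Complex.imCLM.intervalIntegral_comp_comm hgx).symm
  apply Complex.ext <;> simp [h1, h2]

/-- The fundamental theorem of calculus for complex absolutely continuous functions. -/
theorem integral_eq_sub_of_absolutelyContinuous {f g : ℝ → ℂ} {a b : ℝ}
    (hf : AbsolutelyContinuousOnInterval f a b)
    (hd : ∀ᵐ x, x ∈ uIcc a b → HasDerivAt f (g x) x) (hg : IntervalIntegrable g volume a b) :
    ∫ x in a..b, g x = f b - f a := by
  -- The difference is absolutely continuous with derivative zero almost everywhere, hence constant.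
  have hac : AbsolutelyContinuousOnInterval (fun x => f x - ∫ t in a..x, g t) a b :=
    hf.sub (absolutelyContinuousOnInterval_primitive hg left_mem_uIcc)
  obtain ⟨C, hC⟩ := hac.const_of_ae_hasDerivAt_zero (by
    filter_upwards [hd, hg.ae_hasDerivAt_integral] with x h1 h2 hx
    have := (h1 hx).sub (h2 hx a left_mem_uIcc)
    rwa [sub_self] at this)
  have h1 := hC a left_mem_uIcc
  have h2 := hC b right_mem_uIcc
  simp only [intervalIntegral.integral_same, sub_zero] at h1
  rw [← h1] at h2
  linear_combination -h2

theorem ae_mem_uIoo {a b : ℝ} : ∀ᵐ x : ℝ, x ∈ uIcc a b → x ∈ Ioo (min a b) (max a b) := by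
  filter_upwards [volume.ae_ne (min a b), volume.ae_ne (max a b)] with x h1 h2 hx
  exact ⟨lt_of_le_of_ne hx.1 (Ne.symm h1), lt_of_le_of_ne hx.2 h2⟩

/-- `u` is continuously differentiable on `I` with `u' = u₁`, and `u₁` is a primitive of the locally
integrable function `u₂`. -/
structure IsAC2 (I : Opens ℝ) (u u₁ u₂ : ℝ → ℂ) : Prop where
  hasDerivAt : ∀ t ∈ I, HasDerivAt u (u₁ t) t
  intervalIntegrable : ∀ a b, uIcc a b ⊆ (I : Set ℝ) → IntervalIntegrable u₂ volume a b
  integral_eq : ∀ a b, uIcc a b ⊆ (I : Set ℝ) → ∫ x in a..b, u₂ x = u₁ b - u₁ a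

namespace IsAC2

variable {I : Opens ℝ} {u u₁ u₂ v v₁ v₂ : ℝ → ℂ}

theorem locAC_deriv (h : IsAC2 I u u₁ u₂) : LocAC I u₁ := fun a b hab => by
  have hac := absolutelyContinuousOnInterval_primitive (h.intervalIntegrable a b hab)
    (left_mem_uIcc)
  have hconst : AbsolutelyContinuousOnInterval (fun _ : ℝ => u₁ a) a b :=
    (contDiff_const (n := 1)).contDiffOn.absolutelyContinuousOnInterval
  refine ac_congr (fun x hx => ?_) (hac.add hconst)
  have := h.integral_eq a x ((uIcc_subset_uIcc_left hx).trans hab)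
  simp [this]

theorem integral_deriv_eq (h : IsAC2 I u u₁ u₂) {a b : ℝ} (hab : uIcc a b ⊆ (I : Set ℝ)) :
    ∫ x in a..b, u₁ x = u b - u a :=
  intervalIntegral.integral_eq_sub_of_hasDerivAt (fun x hx => h.hasDerivAt x (hab hx))
    (h.locAC_deriv.continuousOn.mono hab).intervalIntegrable

theorem locAC (h : IsAC2 I u u₁ u₂) : LocAC I u := fun a b hab => by
  have hac := absolutelyContinuousOnInterval_primitive
    (h.locAC_deriv.continuousOn.mono hab).intervalIntegrable (left_mem_uIcc)
  have hconst : AbsolutelyContinuousOnInterval (fun _ : ℝ => u a) a b :=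
    (contDiff_const (n := 1)).contDiffOn.absolutelyContinuousOnInterval
  refine ac_congr (fun x hx => ?_) (hac.add hconst)
  have := h.integral_deriv_eq ((uIcc_subset_uIcc_left hx).trans hab)
  simp [this]

/-- Lebesgue differentiation of the primitive of `u₂`. The two endpoints are discarded because the
primitive represents `u₁` in a full neighbourhood only at interior points. -/
theorem ae_hasDerivAt (h : IsAC2 I u u₁ u₂) {a b : ℝ} (hab : uIcc a b ⊆ (I : Set ℝ)) :
    ∀ᵐ x, x ∈ uIcc a b → HasDerivAt u₁ (u₂ x) x := by
  filter_upwards [(h.intervalIntegrable a b hab).ae_hasDerivAt_integral, ae_mem_uIoo] with x h1 h2 hx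
  have h3 := (h1 hx a left_mem_uIcc).add_const (u₁ a)
  refine h3.congr_of_eventuallyEq ?_
  filter_upwards [Ioo_mem_nhds (h2 hx).1 (h2 hx).2] with y hy
  rw [h.integral_eq a y ((uIcc_subset_uIcc_left (Ioo_subset_Icc_self hy)).trans hab)]
  ring

theorem ae_restrict_hasDerivAt (h : IsAC2 I u u₁ u₂) :
    ∀ᵐ x ∂(volume.restrict (I : Set ℝ)), HasDerivAt u₁ (u₂ x) x := by
  rw [ae_restrict_iff' I.isOpen.measurableSet, ae_iff]
  refine measure_null_of_locally_null _ fun x hx => ?_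
  have hxI : x ∈ I := by
    by_contra h
    exact hx fun hx' => absurd hx' h
  obtain ⟨ε, hε, hb⟩ := Metric.isOpen_iff.1 I.isOpen x hxI
  have hsub : uIcc (x - ε / 2) (x + ε / 2) ⊆ (I : Set ℝ) := by
    refine Subset.trans ?_ hb
    rw [uIcc_of_le (by linarith), Real.ball_eq_Ioo]
    intro y hy
    exact ⟨by linarith [hy.1], by linarith [hy.2]⟩
  refine ⟨_ ∩ uIcc (x - ε / 2) (x + ε / 2), inter_mem self_mem_nhdsWithin
    (mem_nhdsWithin_of_mem_nhds ?_), ?_⟩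
  · rw [uIcc_of_le (by linarith)]
    exact Icc_mem_nhds (by linarith) (by linarith)
  · have := h.ae_hasDerivAt hsub
    rw [ae_iff] at this
    refine measure_mono_null ?_ this
    rintro y ⟨hy, hy'⟩ h
    exact hy fun _ => h hy'

theorem eqOn_deriv (h : IsAC2 I u u₁ u₂) : EqOn u₁ (deriv u) (I : Set ℝ) :=
  fun t ht => (h.hasDerivAt t ht).deriv.symm

theorem mem_maxSpace (h : IsAC2 I u u₁ u₂) : u ∈ maxSpace I :=
  ⟨h.locAC, fun t ht => (h.hasDerivAt t ht).differentiableAt, h.locAC_deriv.congr h.eqOn_deriv⟩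

/-- Only almost everywhere: where `u₁` is not differentiable, `deriv` returns the default value 0
instead of `u₂`. -/
theorem osc_ae_eq (h : IsAC2 I u u₁ u₂) : osc u =ᵐ[volume.restrict (I : Set ℝ)]
    fun t => -(1 / 2) * u₂ t + (1 / 2) * (t : ℂ) ^ 2 * u t := by
  filter_upwards [h.ae_restrict_hasDerivAt, ae_restrict_mem I.isOpen.measurableSet] with t h1 ht
  have : deriv (deriv u) t = u₂ t := by
    rw [← h1.deriv]
    exact (h.eqOn_deriv.symm.eventuallyEq_of_mem (I.isOpen.mem_nhds ht)).deriv_eq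
  rw [osc, this]

theorem conjugate (h : IsAC2 I u u₁ u₂) :
    IsAC2 I (fun t => conj (u t)) (fun t => conj (u₁ t)) (fun t => conj (u₂ t)) where
  hasDerivAt t ht := (h.hasDerivAt t ht).star
  intervalIntegrable a b hab :=
    ⟨Complex.conjCLE.toContinuousLinearMap.integrable_comp (h.intervalIntegrable a b hab).1,
      Complex.conjCLE.toContinuousLinearMap.integrable_comp (h.intervalIntegrable a b hab).2⟩
  integral_eq a b hab := by
    rw [← map_sub, ← h.integral_eq a b hab]
    exact Complex.conjCLE.toContinuousLinearMap.intervalIntegral_comp_comm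
      (h.intervalIntegrable a b hab)

/-- Integration by parts for `u · v'`. -/
theorem integral_mul_deriv (hu : IsAC2 I u u₁ u₂) (hv : IsAC2 I v v₁ v₂) {a b : ℝ}
    (hab : uIcc a b ⊆ (I : Set ℝ)) :
    IntervalIntegrable (fun t => u₁ t * v₁ t + u t * v₂ t) volume a b ∧
    ∫ t in a..b, (u₁ t * v₁ t + u t * v₂ t) = u b * v₁ b - u a * v₁ a := by
  have hi : IntervalIntegrable (fun t => u₁ t * v₁ t + u t * v₂ t) volume a b := by
    refine IntervalIntegrable.add ?_ ?_
    · exact ((hu.locAC_deriv.continuousOn.mono hab).mul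
        (hv.locAC_deriv.continuousOn.mono hab)).intervalIntegrable
    · exact (hv.intervalIntegrable a b hab).continuousOn_mul (hu.locAC.continuousOn.mono hab)
  refine ⟨hi, ?_⟩
  have hac : AbsolutelyContinuousOnInterval (u • v₁) a b :=
    (hu.locAC a b hab).smul (hv.locAC_deriv a b hab)
  refine integral_eq_sub_of_absolutelyContinuous hac ?_ hi
  filter_upwards [hv.ae_hasDerivAt hab] with t h1 ht
  exact (hu.hasDerivAt t (hab ht)).mul (h1 ht)

/-- Lagrange's identity. -/
theorem lagrange (hu : IsAC2 I u u₁ u₂) (hv : IsAC2 I v v₁ v₂) {a b : ℝ}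
    (hab : uIcc a b ⊆ (I : Set ℝ)) :
    ∫ t in a..b, (u t * v₂ t - u₂ t * v t) =
      (u b * v₁ b - u₁ b * v b) - (u a * v₁ a - u₁ a * v a) := by
  obtain ⟨i1, e1⟩ := hu.integral_mul_deriv hv hab
  obtain ⟨i2, e2⟩ := hv.integral_mul_deriv hu hab
  have : ∫ t in a..b, (u t * v₂ t - u₂ t * v t) = (∫ t in a..b, (u₁ t * v₁ t + u t * v₂ t)) -
      ∫ t in a..b, (v₁ t * u₁ t + v t * u₂ t) := by
    rw [← intervalIntegral.integral_sub i1 i2]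
    exact intervalIntegral.integral_congr fun t _ => by ring
  rw [this, e1, e2]
  ring

theorem add (hu : IsAC2 I u u₁ u₂) (hv : IsAC2 I v v₁ v₂) :
    IsAC2 I (fun t => u t + v t) (fun t => u₁ t + v₁ t) (fun t => u₂ t + v₂ t) where
  hasDerivAt t ht := (hu.hasDerivAt t ht).add (hv.hasDerivAt t ht)
  intervalIntegrable a b hab :=
    (hu.intervalIntegrable a b hab).add (hv.intervalIntegrable a b hab)
  integral_eq a b hab := by
    rw [intervalIntegral.integral_add (hu.intervalIntegrable a b hab)
      (hv.intervalIntegrable a b hab), hu.integral_eq a b hab, hv.integral_eq a b hab]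
    ring

theorem of_contDiff (h : ContDiff ℝ 2 u) : IsAC2 I u (deriv u) (deriv (deriv u)) := by
  have h1 : ContDiff ℝ 1 (deriv u) := by
    have : ContDiff ℝ (1 + 1) u := h
    exact (contDiff_succ_iff_deriv.1 this).2.2
  have h2 : Continuous (deriv (deriv u)) := h1.continuous_deriv le_rfl
  exact ⟨fun t _ => (h.differentiable (by norm_num) t).hasDerivAt,
    fun a b _ => h2.intervalIntegrable a b,
    fun a b _ => intervalIntegral.integral_eq_sub_of_hasDerivAt
      (fun x _ => (h1.differentiable (by norm_num) x).hasDerivAt) (h2.intervalIntegrable a b)⟩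

end IsAC2

theorem IsAC2.of_mem_maxSpace {I : Opens ℝ} {u : ℝ → ℂ} (h : u ∈ maxSpace I)
    (hi : ∀ a b, uIcc a b ⊆ (I : Set ℝ) → IntervalIntegrable (deriv (deriv u)) volume a b) :
    IsAC2 I u (deriv u) (deriv (deriv u)) where
  hasDerivAt t ht := (h.2.1 t ht).hasDerivAt
  intervalIntegrable := hi
  integral_eq a b hab := by
    refine integral_eq_sub_of_absolutelyContinuous (h.2.2 a b hab) ?_ (hi a b hab)
    filter_upwards [(ae_restrict_iff' I.isOpen.measurableSet).1 h.2.2.ae_differentiableAt]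
      with t h1 ht
    exact (h1 (hab ht)).hasDerivAt

/-- `u` belongs to the maximal domain, with `u' = u₁` and `𝒜u = f`. -/
structure IsMaximal (I : Opens ℝ) (u u₁ f : ℝ → ℂ) : Prop extends
    IsAC2 I u u₁ (fun t => (t : ℂ) ^ 2 * u t - 2 * f t) where
  memLp : MemLp u 2 (volume.restrict (I : Set ℝ))
  memLp_osc : MemLp f 2 (volume.restrict (I : Set ℝ))

/-- The set need not be compact inside `I`: square integrability gives integrability up to the
boundary point 0, which is what produces boundary values. -/
theorem integrableOn_inter_Icc {I : Opens ℝ} {u f : ℝ → ℂ}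
    (hu : MemLp u 2 (volume.restrict (I : Set ℝ))) (hf : MemLp f 2 (volume.restrict (I : Set ℝ)))
    (a b : ℝ) : IntegrableOn (fun t : ℝ => (t : ℂ) ^ 2 * u t - 2 * f t) (I ∩ Icc a b) := by
  have key : ∀ {w : ℝ → ℂ}, MemLp w 2 (volume.restrict (I : Set ℝ)) →
      IntegrableOn w (I ∩ Icc a b) := fun {w} hw => by
    have hfin : IsFiniteMeasure (volume.restrict ((I : Set ℝ) ∩ Icc a b)) :=
      ⟨by rw [Measure.restrict_apply_univ]
          exact (measure_mono inter_subset_right).trans_lt measure_Icc_lt_top⟩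
    have hw' : MemLp w 2 (volume.restrict ((I : Set ℝ) ∩ Icc a b)) :=
      hw.mono_measure (Measure.restrict_mono inter_subset_left le_rfl)
    exact hw'.integrable (by norm_num)
  refine Integrable.sub ?_ ((key hf).const_mul 2)
  obtain ⟨C, hC⟩ := isCompact_Icc.exists_bound_of_continuousOn (s := Icc a b)
    (f := fun t : ℝ => (t : ℂ) ^ 2) (by fun_prop)
  refine (key hu).bdd_mul (c := C) (by fun_prop) ?_
  filter_upwards [ae_restrict_mem (I.isOpen.measurableSet.inter measurableSet_Icc)] with t ht
  exact hC t ht.2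

theorem intervalIntegrable_of_memLp {I : Opens ℝ} {u f : ℝ → ℂ}
    (hu : MemLp u 2 (volume.restrict (I : Set ℝ))) (hf : MemLp f 2 (volume.restrict (I : Set ℝ)))
    {a b : ℝ} (hab : uIcc a b ⊆ (I : Set ℝ)) :
    IntervalIntegrable (fun t : ℝ => (t : ℂ) ^ 2 * u t - 2 * f t) volume a b := by
  rw [intervalIntegrable_iff]
  refine (integrableOn_inter_Icc hu hf (min a b) (max a b)).mono_set fun t ht => ?_
  exact ⟨hab (uIoc_subset_uIcc ht), uIoc_subset_uIcc ht⟩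

/-- Solving 𝒜u = f for the second derivative gives u'' = t²u - 2f, which is locally integrable
because u and f are square integrable. -/
theorem IsMaximal.of_mem_maxSpace {I : Opens ℝ} {u : ℝ → ℂ} (h : u ∈ maxSpace I)
    (hu : MemLp u 2 (volume.restrict (I : Set ℝ)))
    (ho : MemLp (osc u) 2 (volume.restrict (I : Set ℝ))) :
    IsMaximal I u (deriv u) (osc u) := by
  have heq : (fun t : ℝ => (t : ℂ) ^ 2 * u t - 2 * osc u t) = deriv (deriv u) := by
    ext t
    rw [osc]
    ring
  refine ⟨?_, hu, ho⟩
  rw [heq]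
  refine IsAC2.of_mem_maxSpace h fun a b hab => ?_
  rw [← heq]
  exact intervalIntegrable_of_memLp hu ho hab

theorem memLp_conjugate {μ : Measure ℝ} {u : ℝ → ℂ} (h : MemLp u 2 μ) :
    MemLp (fun t => conj (u t)) 2 μ :=
  h.of_le (Complex.continuous_conj.comp_aestronglyMeasurable h.1) (by simp)

theorem IsMaximal.conjugate {I : Opens ℝ} {u u₁ f : ℝ → ℂ} (h : IsMaximal I u u₁ f) :
    IsMaximal I (fun t => conj (u t)) (fun t => conj (u₁ t)) (fun t => conj (f t)) := by
  refine ⟨?_, memLp_conjugate h.memLp, memLp_conjugate h.memLp_osc⟩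
  have := h.toIsAC2.conjugate
  simp only [map_sub, map_mul, map_pow, Complex.conj_ofReal, map_ofNat] at this
  exact this

end HalfLineOscillator

/-! ### Behaviour at 0 and at infinity, and Green's identity -/

namespace HalfLineOscillator

open ComplexConjugate

theorem uIcc_subset_pos {a b : ℝ} (ha : 0 < a) (hb : 0 < b) :
    uIcc a b ⊆ (posHalfLine : Set ℝ) := fun _ hx => (lt_min ha hb).trans_le hx.1

/-- The integral over [t, 1] depends continuously on `t` down to 0, since `w` is integrable up to 0.
-/
theorem tendsto_zero_right_of_integral_eq {w W : ℝ → ℂ} (hw : IntegrableOn w (Ioc 0 1))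
    (h : ∀ t, 0 < t → ∫ x in t..1, w x = W 1 - W t) :
    Tendsto W (𝓝[>] 0) (𝓝 (W 1 - ∫ x in (0 : ℝ)..1, w x)) := by
  have hw' : IntegrableOn w (uIcc 0 1) := by
    rwa [uIcc_of_le zero_le_one, integrableOn_Icc_iff_integrableOn_Ioc]
  have hc := intervalIntegral.continuousOn_primitive_interval_left hw' 0 left_mem_uIcc
  rw [uIcc_of_le zero_le_one] at hc
  have hc' : Tendsto (fun t => ∫ x in t..1, w x) (𝓝[>] 0) (𝓝 (∫ x in (0 : ℝ)..1, w x)) := by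
    rw [← nhdsWithin_Ioc_eq_nhdsGT zero_lt_one]
    exact hc.mono_left (nhdsWithin_mono _ Ioc_subset_Icc_self)
  refine (hc'.const_sub (W 1)).congr' ?_
  filter_upwards [self_mem_nhdsWithin] with t ht
  rw [h t ht]
  ring

/-- The fundamental theorem of calculus on `(0, ∞)`. -/
theorem integral_Ioi_zero_eq_sub {w W : ℝ → ℂ} {A B : ℂ} (hw : IntegrableOn w (Ioi 0))
    (h : ∀ a b, 0 < a → 0 < b → ∫ x in a..b, w x = W b - W a)
    (hA : Tendsto W (𝓝[>] 0) (𝓝 A)) (hB : Tendsto W atTop (𝓝 B)) :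
    ∫ x in Ioi 0, w x = B - A := by
  have h1 := tendsto_nhds_unique hA (tendsto_zero_right_of_integral_eq
    (hw.mono_set Ioc_subset_Ioi_self) fun t ht => h t 1 ht one_pos)
  have h2 := tendsto_nhds_unique (intervalIntegral_tendsto_integral_Ioi 1
    (hw.mono_set (Ioi_subset_Ioi zero_le_one)) tendsto_id)
    ((hB.sub_const (W 1)).congr' (by
      filter_upwards [eventually_gt_atTop 0] with t ht
      exact (h 1 t one_pos ht).symm))
  have h3 : ∫ x in Ioi 0, w x = (∫ x in Ioc 0 1, w x) + ∫ x in Ioi 1, w x := by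
    rw [← setIntegral_union (Ioc_disjoint_Ioi le_rfl) measurableSet_Ioi
      (hw.mono_set Ioc_subset_Ioi_self) (hw.mono_set (Ioi_subset_Ioi zero_le_one)),
      Ioc_union_Ioi_eq_Ioi zero_le_one]
  rw [h3, h2, ← intervalIntegral.integral_of_le zero_le_one, h1]
  ring

section Positive

variable {u u₁ f v v₁ g : ℝ → ℂ}

/-- A function in the maximal domain has boundary values at `0`. -/
theorem exists_boundary_values_pos (h : IsMaximal posHalfLine u u₁ f) :
    ∃ a b : ℂ, Tendsto u (𝓝[>] 0) (𝓝 a) ∧ Tendsto u₁ (𝓝[>] 0) (𝓝 b) := by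
  have hi2 : IntegrableOn (fun t : ℝ => (t : ℂ) ^ 2 * u t - 2 * f t) (Ioc 0 1) :=
    (integrableOn_inter_Icc h.memLp h.memLp_osc 0 1).mono_set fun t ht =>
      ⟨ht.1, Ioc_subset_Icc_self ht⟩
  have h1 := tendsto_zero_right_of_integral_eq hi2
    fun t ht => h.integral_eq t 1 (uIcc_subset_pos ht one_pos)
  -- On (0, 1], `u₁` coincides with a function continuous on all of [0, 1]; its integrability lets
  -- the same lemma apply to `u`.
  have hi1 : IntegrableOn u₁ (Ioc 0 1) := by
    have hw' : IntegrableOn (fun t : ℝ => (t : ℂ) ^ 2 * u t - 2 * f t) (uIcc 0 1) := by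
      rwa [uIcc_of_le zero_le_one, integrableOn_Icc_iff_integrableOn_Ioc]
    have hc := (continuousOn_const (c := u₁ 1)).sub
      (intervalIntegral.continuousOn_primitive_interval_left hw')
    rw [uIcc_of_le zero_le_one] at hc
    refine (hc.integrableOn_Icc.mono_set Ioc_subset_Icc_self).congr_fun (fun t ht => ?_)
      measurableSet_Ioc
    have := h.integral_eq t 1 (uIcc_subset_pos ht.1 one_pos)
    change u₁ 1 - ∫ x in t..1, ((x : ℂ) ^ 2 * u x - 2 * f x) = u₁ t
    rw [this]
    ring
  exact ⟨_, _, tendsto_zero_right_of_integral_eq hi1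
    fun t ht => h.toIsAC2.integral_deriv_eq (uIcc_subset_pos ht one_pos), h1⟩

theorem integrable_mul_of_memLp {μ : Measure ℝ} {u v : ℝ → ℂ} (hu : MemLp u 2 μ)
    (hv : MemLp v 2 μ) : Integrable (fun t => u t * v t) μ :=
  hu.integrable_mul hv

/-- Since `u` is square integrable, `Re (u̅ u')` cannot stay above `1`. -/
theorem frequently_re_conj_mul_le (h : IsMaximal posHalfLine u u₁ f) :
    ∃ᶠ t in atTop, (conj (u t) * u₁ t).re ≤ 1 := by
  by_contra hcon
  rw [not_frequently] at hcon
  obtain ⟨R, hR⟩ := eventually_atTop.1 (hcon.and (eventually_gt_atTop 0))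
  have hR0 : 0 < R := (hR R le_rfl).2
  -- The derivative of |u|² is 2 Re(u̅ u'); were it above 2 beyond `R`, |u|² would grow at least
  -- linearly.
  have hderiv : ∀ t, R ≤ t → HasDerivAt (fun s => (conj (u s) * u s).re)
      (2 * (conj (u t) * u₁ t).re) t := fun t ht => by
    have hu := h.hasDerivAt t (show t ∈ Ioi (0 : ℝ) from hR0.trans_le ht)
    have hc : HasDerivAt (fun s => conj (u s)) (conj (u₁ t)) t := hu.star
    have := Complex.reCLM.hasFDerivAt.comp_hasDerivAt t (hc.mul hu)
    refine this.congr_deriv ?_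
    simp only [Complex.reCLM_apply, Complex.add_re, Complex.mul_re, Complex.conj_re,
      Complex.conj_im]
    ring
  have hmono : ∀ t, R < t → 2 * (t - R) ≤ (conj (u t) * u t).re := fun t ht => by
    obtain ⟨s, hs, hst⟩ := exists_hasDerivAt_eq_slope (fun s => (conj (u s) * u s).re)
      (fun t => 2 * (conj (u t) * u₁ t).re) ht
      (fun s hs => (hderiv s hs.1).continuousAt.continuousWithinAt)
      (fun s hs => hderiv s hs.1.le)
    have h1 : 1 < (conj (u s) * u₁ s).re := not_le.1 (hR s hs.1.le).1
    have h2 : 2 < ((conj (u t) * u t).re - (conj (u R) * u R).re) / (t - R) := by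
      rw [← hst]
      linarith
    rw [lt_div_iff₀ (sub_pos.2 ht)] at h2
    have h3 : 0 ≤ (conj (u R) * u R).re := by
      rw [mul_comm, Complex.mul_conj, Complex.ofReal_re]
      exact Complex.normSq_nonneg _
    linarith
  have hint : IntegrableOn (fun t => (conj (u t) * u t).re) (Ioi (R + 1)) := by
    have : Integrable (fun t => conj (u t) * u t) (volume.restrict (Ioi 0)) :=
      integrable_mul_of_memLp (memLp_conjugate h.memLp) h.memLp
    exact this.re.mono_measure (Measure.restrict_mono
      (Ioi_subset_Ioi (by linarith)) le_rfl)
  -- Beyond `R + 1` the lower bound 2(t - R) exceeds 1, so an integrable |u|² would dominate the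
  -- constant 1 on a half-line.
  have hone : IntegrableOn (fun _ : ℝ => (1 : ℝ)) (Ioi (R + 1)) := by
    refine Integrable.mono' hint (by fun_prop) ?_
    filter_upwards [ae_restrict_mem measurableSet_Ioi] with t ht
    have ht' : R + 1 < t := ht
    rw [norm_one]
    linarith [hmono t (by linarith)]
  rw [integrableOn_const_iff] at hone
  simp at hone

/-- The derivative of a function in the maximal domain is square integrable at infinity. -/
theorem memLp_deriv (h : IsMaximal posHalfLine u u₁ f) :
    MemLp u₁ 2 (volume.restrict (Ioi 1)) := by
  have hcont : ContinuousOn u₁ (Ioi 0) := h.locAC_deriv.continuousOn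
  have hmeas : AEStronglyMeasurable u₁ (volume.restrict (Ioi 1)) :=
    (hcont.mono (Ioi_subset_Ioi zero_le_one)).aestronglyMeasurable measurableSet_Ioi
  rw [memLp_two_iff_integrable_sq_norm hmeas]
  have hfu : Integrable (fun t => conj (u t) * f t) (volume.restrict (Ioi 0)) :=
    integrable_mul_of_memLp (memLp_conjugate h.memLp) h.memLp_osc
  set C : ℝ := ∫ t in Ioi 0, ‖conj (u t) * f t‖ with hC
  have hsub : ∀ R, 1 ≤ R → uIcc 1 R ⊆ Ioi (0 : ℝ) := fun R hR =>
    uIcc_subset_pos one_pos (one_pos.trans_le hR)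
  have hint : ∀ R, 1 ≤ R → IntervalIntegrable (fun t => ‖u₁ t‖ ^ 2) volume 1 R := fun R hR =>
    ((hcont.mono (hsub R hR)).norm.pow 2).intervalIntegrable
  -- Integrate (u̅ u')' = |u'|² + t²|u|² - 2u̅f over [1, R], take real parts and drop the
  -- nonnegative term t²|u|².
  have hbound : ∀ R, 1 ≤ R → (conj (u R) * u₁ R).re ≤ 1 →
      ∫ t in (1 : ℝ)..R, ‖u₁ t‖ ^ 2 ≤ 1 - (conj (u 1) * u₁ 1).re + 2 * C := by
    intro R hR hle
    obtain ⟨hi, he⟩ := h.toIsAC2.conjugate.integral_mul_deriv h.toIsAC2 (hsub R hR)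
    have hfi : IntervalIntegrable (fun t => ‖conj (u t) * f t‖) volume 1 R := by
      rw [intervalIntegrable_iff]
      exact hfu.norm.mono_measure (Measure.restrict_mono
        (uIoc_subset_uIcc.trans (hsub R hR)) le_rfl)
    have h1 : ∫ t in (1 : ℝ)..R, (conj (u₁ t) * u₁ t +
        conj (u t) * ((t : ℂ) ^ 2 * u t - 2 * f t)).re =
        (conj (u R) * u₁ R).re - (conj (u 1) * u₁ 1).re := by
      rw [← Complex.sub_re, ← he]
      exact Complex.reCLM.intervalIntegral_comp_comm hi
    have h2 : ∫ t in (1 : ℝ)..R, (‖u₁ t‖ ^ 2 - 2 * ‖conj (u t) * f t‖) ≤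
        ∫ t in (1 : ℝ)..R, (conj (u₁ t) * u₁ t +
          conj (u t) * ((t : ℂ) ^ 2 * u t - 2 * f t)).re := by
      refine intervalIntegral.integral_mono_on hR ((hint R hR).sub (hfi.const_mul 2))
        ⟨hi.1.re, hi.2.re⟩ fun t _ => ?_
      have e1 : conj (u₁ t) * u₁ t + conj (u t) * ((t : ℂ) ^ 2 * u t - 2 * f t) =
          ((‖u₁ t‖ ^ 2 + t ^ 2 * ‖u t‖ ^ 2 : ℝ) : ℂ) - 2 * (conj (u t) * f t) := by
        push_cast
        rw [← Complex.conj_mul', ← Complex.conj_mul']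
        ring
      rw [e1, Complex.sub_re, Complex.ofReal_re]
      have e2 := Complex.re_le_norm (conj (u t) * f t)
      have e3 : (2 * (conj (u t) * f t)).re = 2 * (conj (u t) * f t).re := by simp
      have e4 : 0 ≤ t ^ 2 * ‖u t‖ ^ 2 := by positivity
      rw [e3]
      linarith
    rw [intervalIntegral.integral_sub (hint R hR) (hfi.const_mul 2),
      intervalIntegral.integral_const_mul] at h2
    have h3 : ∫ t in (1 : ℝ)..R, ‖conj (u t) * f t‖ ≤ C := by
      rw [intervalIntegral.integral_of_le hR, hC]
      exact setIntegral_mono_set hfu.norm (ae_of_all _ fun _ => norm_nonneg _)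
        (Eventually.of_forall fun t ht => one_pos.trans ht.1)
    linarith
  refine integrableOn_Ioi_of_intervalIntegral_norm_bounded (b := fun n : ℝ => max n 1) (l := atTop)
    (1 - (conj (u 1) * u₁ 1).re + 2 * C) 1 (fun n => ?_)
    (tendsto_atTop_mono (fun n => le_max_left n 1) tendsto_id) (Eventually.of_forall fun n => ?_)
  · rw [← intervalIntegrable_iff_integrableOn_Ioc_of_le (le_max_right _ _)]
    exact hint _ (le_max_right _ _)
  -- The energy bound is available only at some arbitrarily large `R`; enlarging the upper limit to
  -- such an `R` can only increase the integral of |u'|².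
  · obtain ⟨R, hR, hle⟩ := frequently_atTop.1 (frequently_re_conj_mul_le h) (max n 1)
    have hR1 : 1 ≤ R := (le_max_right _ _).trans hR
    refine le_trans ?_ (hbound R hR1 hle)
    have : ∫ t in (1 : ℝ)..max n 1, ‖‖u₁ t‖ ^ 2‖ = ∫ t in (1 : ℝ)..max n 1, ‖u₁ t‖ ^ 2 := by
      refine intervalIntegral.integral_congr fun t _ => ?_
      simp
    rw [this]
    exact intervalIntegral.integral_mono_interval le_rfl (le_max_right _ _) hR
      (ae_of_all _ fun _ => by positivity) (hint R hR1)

/-- Green's identity on `(0, ∞)`; there is no contribution from infinity. -/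
theorem green_pos (hu : IsMaximal posHalfLine u u₁ f) (hv : IsMaximal posHalfLine v v₁ g)
    {a b c d : ℂ} (ha : Tendsto u (𝓝[>] 0) (𝓝 a)) (hb : Tendsto u₁ (𝓝[>] 0) (𝓝 b))
    (hc : Tendsto v (𝓝[>] 0) (𝓝 c)) (hd : Tendsto v₁ (𝓝[>] 0) (𝓝 d)) :
    ∫ t in Ioi 0, (f t * v t - u t * g t) = -(1 / 2) * (a * d - b * c) := by
  set W : ℝ → ℂ := fun t => (1 / 2) * (u t * v₁ t - u₁ t * v t) with hW
  have hint : IntegrableOn (fun t => f t * v t - u t * g t) (Ioi 0) :=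
    (integrable_mul_of_memLp hu.memLp_osc hv.memLp).sub
      (integrable_mul_of_memLp hu.memLp hv.memLp_osc)
  have hFTC : ∀ r s, 0 < r → 0 < s → ∫ t in r..s, (f t * v t - u t * g t) = W s - W r := by
    intro r s hr hs
    have := hu.toIsAC2.lagrange hv.toIsAC2 (uIcc_subset_pos hr hs)
    simp only [hW]
    rw [← mul_sub, ← this, ← intervalIntegral.integral_const_mul]
    exact intervalIntegral.integral_congr fun t _ => by ring
  have hW0 : Tendsto W (𝓝[>] 0) (𝓝 ((1 / 2) * (a * d - b * c))) :=
    ((ha.mul hd).sub (hb.mul hc)).const_mul _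
  -- Square integrability of both derivatives makes the Wronskian integrable. It also converges at
  -- infinity, and an integrable function can converge only to 0.
  have hWint : IntegrableOn W (Ioi 1) := by
    have hu' : MemLp u 2 (volume.restrict (Ioi 1)) :=
      hu.memLp.mono_measure (Measure.restrict_mono (Ioi_subset_Ioi zero_le_one) le_rfl)
    have hv' : MemLp v 2 (volume.restrict (Ioi 1)) :=
      hv.memLp.mono_measure (Measure.restrict_mono (Ioi_subset_Ioi zero_le_one) le_rfl)
    exact ((integrable_mul_of_memLp hu' (memLp_deriv hv)).sub
      (integrable_mul_of_memLp (memLp_deriv hu) hv')).const_mul _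
  have hlim : Tendsto W atTop (𝓝 (W 1 + ∫ t in Ioi 1, (f t * v t - u t * g t))) := by
    have := intervalIntegral_tendsto_integral_Ioi 1
      (hint.mono_set (Ioi_subset_Ioi zero_le_one)) tendsto_id
    refine (this.const_add (W 1)).congr' ?_
    filter_upwards [eventually_gt_atTop 0] with t ht
    simp only [id]
    rw [hFTC 1 t one_pos ht]
    ring
  have hzero : W 1 + ∫ t in Ioi 1, (f t * v t - u t * g t) = 0 := by
    have hat : IntegrableAtFilter W atTop := ⟨Ioi 1, Ioi_mem_atTop _, hWint⟩
    refine IntegrableAtFilter.eq_zero_of_tendsto hat (fun s hs => ?_) hlim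
    obtain ⟨r, hr⟩ := mem_atTop_sets.1 hs
    rw [← top_le_iff, ← Real.volume_Ici (a := r)]
    exact measure_mono hr
  rw [hzero] at hlim
  rw [integral_Ioi_zero_eq_sub hint hFTC hW0 hlim]
  ring

end Positive

/-! ### Transfer to the negative half-line by reflection -/

section HalfLine

/-- Reflection `t ↦ -t`. -/
theorem IsAC2.reflect {u u₁ u₂ : ℝ → ℂ} (h : IsAC2 negHalfLine u u₁ u₂) :
    IsAC2 posHalfLine (fun t => u (-t)) (fun t => -u₁ (-t)) (fun t => u₂ (-t)) := by
  have hsub : ∀ {a b : ℝ}, uIcc a b ⊆ (posHalfLine : Set ℝ) →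
      uIcc (-a) (-b) ⊆ (negHalfLine : Set ℝ) := fun {a b} hab => by
    have ha : 0 < a := hab left_mem_uIcc
    have hb : 0 < b := hab right_mem_uIcc
    intro x hx
    exact hx.2.trans_lt (max_lt (neg_lt_zero.2 ha) (neg_lt_zero.2 hb))
  refine ⟨fun t ht => ?_, fun a b hab => ?_, fun a b hab => ?_⟩
  · have ht' : -t ∈ negHalfLine := neg_lt_zero.2 (show (0 : ℝ) < t from ht)
    have := (h.hasDerivAt (-t) ht').scomp t (hasDerivAt_neg t)
    simpa [Function.comp_def] using this
  · have := (h.intervalIntegrable _ _ (hsub hab)).comp_mul_left (c := -1)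
    simpa using this
  · rw [intervalIntegral.integral_comp_neg, intervalIntegral.integral_symm,
      h.integral_eq _ _ (hsub hab)]
    ring

theorem map_neg_volume_pos : (volume.restrict (Ioi (0 : ℝ))).map Neg.neg =
    volume.restrict (Iio 0) := by
  have h := ((Measure.measurePreserving_neg (volume : Measure ℝ)).restrict_preimage
    (measurableSet_Iio (a := (0 : ℝ)))).map_eq
  simpa using h

theorem IsMaximal.reflect {u u₁ f : ℝ → ℂ} (h : IsMaximal negHalfLine u u₁ f) :
    IsMaximal posHalfLine (fun t => u (-t)) (fun t => -u₁ (-t)) (fun t => f (-t)) := by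
  have key : ∀ {w : ℝ → ℂ}, MemLp w 2 (volume.restrict (negHalfLine : Set ℝ)) →
      MemLp (fun t => w (-t)) 2 (volume.restrict (posHalfLine : Set ℝ)) := fun {w} hw => by
    have hw' : MemLp w 2 ((volume.restrict (Ioi (0 : ℝ))).map Neg.neg) := by
      rw [map_neg_volume_pos]
      exact hw
    exact hw'.comp_of_map measurable_neg.aemeasurable
  refine ⟨?_, key h.memLp, key h.memLp_osc⟩
  have := h.toIsAC2.reflect
  simpa using this

theorem tendsto_comp_neg {w : ℝ → ℂ} {a : ℂ} :
    Tendsto (fun t => w (-t)) (𝓝[>] 0) (𝓝 a) ↔ Tendsto w (𝓝[<] 0) (𝓝 a) := by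
  have h1 : Tendsto (fun t : ℝ => -t) (𝓝[>] 0) (𝓝[<] 0) := by
    simpa using tendsto_neg_nhdsGT (a := (0 : ℝ))
  have h2 : Tendsto (fun t : ℝ => -t) (𝓝[<] 0) (𝓝[>] 0) := by
    simpa using tendsto_neg_nhdsLT (a := (0 : ℝ))
  exact ⟨fun h => by simpa [Function.comp_def] using h.comp h2, fun h => h.comp h1⟩

variable {I : Opens ℝ}

theorem exists_boundary_values (hI : I = posHalfLine ∨ I = negHalfLine) {u u₁ f : ℝ → ℂ}
    (h : IsMaximal I u u₁ f) : ∃ a b : ℂ, Tendsto u (𝓝[(I : Set ℝ)] 0) (𝓝 a) ∧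
      Tendsto u₁ (𝓝[(I : Set ℝ)] 0) (𝓝 b) := by
  rcases hI with rfl | rfl
  · exact exists_boundary_values_pos h
  · obtain ⟨a, b, ha, hb⟩ := exists_boundary_values_pos h.reflect
    refine ⟨a, -b, tendsto_comp_neg.1 ha, tendsto_comp_neg.1 ?_⟩
    simpa using hb.neg

/-- Green's identity on a half-line. -/
theorem green (hI : I = posHalfLine ∨ I = negHalfLine) : ∃ k : ℂ, k ≠ 0 ∧
    ∀ {u u₁ f v v₁ g : ℝ → ℂ}, IsMaximal I u u₁ f → IsMaximal I v v₁ g → ∀ {a b c d : ℂ},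
      Tendsto u (𝓝[(I : Set ℝ)] 0) (𝓝 a) → Tendsto u₁ (𝓝[(I : Set ℝ)] 0) (𝓝 b) →
      Tendsto v (𝓝[(I : Set ℝ)] 0) (𝓝 c) → Tendsto v₁ (𝓝[(I : Set ℝ)] 0) (𝓝 d) →
      ∫ t in (I : Set ℝ), (f t * v t - u t * g t) = k * (a * d - b * c) := by
  rcases hI with rfl | rfl
  · exact ⟨-(1 / 2), by norm_num, fun hu hv _ _ _ _ ha hb hc hd => green_pos hu hv ha hb hc hd⟩
  -- Reflection negates both derivatives, which reverses the sign of the boundary bracket and hence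
  -- of `k`.
  · refine ⟨1 / 2, by norm_num, fun {u u₁ f v v₁ g} hu hv a b c d ha hb hc hd => ?_⟩
    have := green_pos hu.reflect hv.reflect (tendsto_comp_neg.2 ha) (tendsto_comp_neg.2 hb).neg
      (tendsto_comp_neg.2 hc) (tendsto_comp_neg.2 hd).neg
    rw [integral_comp_neg_Ioi (0 : ℝ) (fun t => f t * v t - u t * g t), neg_zero,
      integral_Iic_eq_integral_Iio] at this
    change ∫ t in Iio 0, _ = _
    rw [this]
    ring

end HalfLine

end HalfLineOscillator

/-! ### Test functions, du Bois-Reymond's lemma and weak solutions -/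

namespace HalfLineOscillator

/-- Real-valued test functions on `I`. -/
structure IsTest (I : Opens ℝ) (φ : ℝ → ℝ) : Prop where
  contDiff : ContDiff ℝ ∞ φ
  hasCompactSupport : HasCompactSupport φ
  tsupport_subset : tsupport φ ⊆ (I : Set ℝ)

namespace IsTest

variable {I : Opens ℝ} {φ ψ : ℝ → ℝ}

theorem differentiable (h : IsTest I φ) : Differentiable ℝ φ := h.contDiff.differentiable (by simp)

theorem integrable (h : IsTest I φ) : Integrable φ :=
  h.contDiff.continuous.integrable_of_hasCompactSupport h.hasCompactSupport

theorem derivative (h : IsTest I φ) : IsTest I (deriv φ) where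
  contDiff := (contDiff_infty_iff_deriv.1 h.contDiff).2
  hasCompactSupport := h.hasCompactSupport.deriv
  tsupport_subset := (tsupport_deriv_subset (𝕜 := ℝ)).trans h.tsupport_subset

theorem sub_const_mul (h : IsTest I φ) (h' : IsTest I ψ) (c : ℝ) :
    IsTest I (fun x => φ x - c * ψ x) where
  contDiff := h.contDiff.sub (contDiff_const.mul h'.contDiff)
  hasCompactSupport := h.hasCompactSupport.sub (h'.hasCompactSupport.mul_left (f := fun _ => c))
  tsupport_subset := by
    refine (tsupport_sub φ _).trans (union_subset h.tsupport_subset ?_)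
    exact (tsupport_smul_subset_right (fun _ => c) ψ).trans h'.tsupport_subset

theorem eq_zero_of_notMem (h : IsTest I φ) {x : ℝ} (hx : x ∉ I) : φ x = 0 :=
  image_eq_zero_of_notMem_tsupport fun hx' => hx (h.tsupport_subset hx')

theorem integrable_smul (h : IsTest I φ) {g : ℝ → ℂ} (hg : LocallyIntegrableOn g (I : Set ℝ)) :
    Integrable (fun x => φ x • g x) := by
  have h1 : Function.support (fun x => φ x • g x) ⊆ tsupport φ := fun x hx =>
    subset_tsupport φ fun h0 => hx (by simp [h0])
  rw [← integrableOn_iff_integrable_of_support_subset h1]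
  obtain ⟨C, hC⟩ := h.hasCompactSupport.exists_bound_of_continuous h.contDiff.continuous
  exact (hg.integrableOn_compact_subset h.tsupport_subset h.hasCompactSupport).bdd_smul C
    h.contDiff.continuous.aestronglyMeasurable (Eventually.of_forall hC)

theorem integral_sub_const_mul_smul (h : IsTest I φ) (h' : IsTest I ψ) (c : ℝ) {g : ℝ → ℂ}
    (hg : LocallyIntegrableOn g (I : Set ℝ)) :
    ∫ x, (φ x - c * ψ x) • g x = (∫ x, φ x • g x) - c • ∫ x, ψ x • g x := by
  have hi : Integrable (fun x => c • ψ x • g x) := (h'.integrable_smul hg).smul c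
  rw [← integral_smul, ← integral_sub (h.integrable_smul hg) hi]
  exact integral_congr_ae (Eventually.of_forall fun x => by simp only [sub_smul, mul_smul])

theorem ofReal_mem_testSpace (h : IsTest I φ) : (fun x => (φ x : ℂ)) ∈ testSpace I :=
  ⟨Complex.ofRealCLM.contDiff.comp h.contDiff,
    h.hasCompactSupport.comp_left (g := fun x : ℝ => (x : ℂ)) Complex.ofReal_zero,
    (tsupport_comp_subset (g := fun x : ℝ => (x : ℂ)) Complex.ofReal_zero φ).trans
      h.tsupport_subset⟩

end IsTest

/-- A compact subset of an open interval is contained in a compact subinterval. -/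
theorem exists_subset_Ioo {I : Opens ℝ} [hI : (I : Set ℝ).OrdConnected] {c : ℝ} (hc : c ∈ I)
    {K : Set ℝ} (hK : IsCompact K) (hKI : K ⊆ (I : Set ℝ)) :
    ∃ a b : ℝ, a < b ∧ Icc a b ⊆ (I : Set ℝ) ∧ K ⊆ Ioo a b := by
  have hK' : IsCompact (insert c K) := hK.insert c
  have hne : (insert c K).Nonempty := insert_nonempty c K
  have hsub : insert c K ⊆ (I : Set ℝ) := insert_subset hc hKI
  obtain ⟨ε, hε, hb⟩ := Metric.isOpen_iff.1 I.isOpen _ (hsub (hK'.sInf_mem hne))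
  obtain ⟨δ, hδ, hb'⟩ := Metric.isOpen_iff.1 I.isOpen _ (hsub (hK'.sSup_mem hne))
  have h1 : ∀ x ∈ insert c K, sInf (insert c K) ≤ x := fun x hx => csInf_le hK'.bddBelow hx
  have h2 : ∀ x ∈ insert c K, x ≤ sSup (insert c K) := fun x hx => le_csSup hK'.bddAbove hx
  refine ⟨sInf (insert c K) - ε / 2, sSup (insert c K) + δ / 2, ?_, ?_, fun x hx => ?_⟩
  · have := (h1 c (mem_insert c K)).trans (h2 c (mem_insert c K))
    linarith
  · refine hI.out (hb ?_) (hb' ?_)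
    · rw [Real.ball_eq_Ioo]
      exact ⟨by linarith, by linarith⟩
    · rw [Real.ball_eq_Ioo]
      exact ⟨by linarith, by linarith⟩
  · have := h1 x (mem_insert_of_mem c hx)
    have := h2 x (mem_insert_of_mem c hx)
    exact ⟨by linarith, by linarith⟩

section DuBoisReymond

variable {I : Opens ℝ} [hI : (I : Set ℝ).OrdConnected]

/-- A test function with vanishing integral is the derivative of a test function. -/
theorem IsTest.exists_deriv_eq {c : ℝ} (hc : c ∈ I) {φ : ℝ → ℝ} (h : IsTest I φ)
    (h0 : ∫ x, φ x = 0) : ∃ Φ, IsTest I Φ ∧ deriv Φ = φ := by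
  obtain ⟨a, b, hab, hsub, hK⟩ := exists_subset_Ioo hc h.hasCompactSupport h.tsupport_subset
  have hz : ∀ x, x ∉ Ioo a b → φ x = 0 := fun x hx =>
    image_eq_zero_of_notMem_tsupport fun hx' => hx (hK hx')
  have hd : ∀ x, HasDerivAt (fun t => ∫ s in a..t, φ s) (φ x) x := fun x =>
    intervalIntegral.integral_hasDerivAt_right (h.contDiff.continuous.intervalIntegrable _ _)
      (h.contDiff.continuous.stronglyMeasurableAtFilter _ _) h.contDiff.continuous.continuousAt
  have hderiv : deriv (fun t => ∫ s in a..t, φ s) = φ := funext fun x => (hd x).deriv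
  -- To the left of `a` the integrand vanishes; to the right of `b` the primitive equals the full
  -- integral, which is 0.
  have hsupp : tsupport (fun t => ∫ s in a..t, φ s) ⊆ Icc a b := by
    refine closure_minimal (fun t ht => ?_) isClosed_Icc
    by_contra hcon
    refine ht ?_
    change ∫ s in a..t, φ s = 0
    rcases lt_or_ge t a with hta | hta
    · rw [intervalIntegral.integral_congr (g := fun _ => (0 : ℝ)) fun s hs => ?_]
      · simp
      · rw [uIcc_of_ge hta.le] at hs
        exact hz s fun hs' => (hs.2.trans_lt hs'.1).false
    · have htb : b < t := not_le.1 fun htb => hcon ⟨hta, htb⟩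
      rw [intervalIntegral.integral_eq_integral_of_support_subset, h0]
      intro s hs
      by_contra hs'
      exact hs (hz s fun hs'' => hs' ⟨hs''.1, (hs''.2.trans htb).le⟩)
  refine ⟨fun t => ∫ s in a..t, φ s, ⟨?_, ?_, hsupp.trans hsub⟩, hderiv⟩
  · rw [contDiff_infty_iff_deriv, hderiv]
    exact ⟨fun x => (hd x).differentiableAt, h.contDiff⟩
  · exact HasCompactSupport.of_support_subset_isCompact isCompact_Icc
      ((subset_tsupport _).trans hsupp)

theorem exists_isTest_integral_eq_one {I : Opens ℝ} {c : ℝ} (hc : c ∈ I) :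
    ∃ ψ, IsTest I ψ ∧ ∫ x, ψ x = 1 := by
  obtain ⟨ε, hε, hb⟩ := Metric.isOpen_iff.1 I.isOpen c hc
  let f : ContDiffBump c := ⟨ε / 4, ε / 2, by positivity, by linarith⟩
  refine ⟨f.normed volume, ⟨f.contDiff_normed, f.hasCompactSupport_normed, ?_⟩, f.integral_normed⟩
  rw [f.tsupport_normed_eq]
  exact (Metric.closedBall_subset_ball (show ε / 2 < ε by linarith)).trans hb

/-- **Du Bois-Reymond's lemma**. -/
theorem ae_eq_const_of_integral_deriv_smul {c : ℝ} (hc : c ∈ I) {g : ℝ → ℂ}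
    (hg : LocallyIntegrableOn g (I : Set ℝ))
    (h : ∀ φ, IsTest I φ → ∫ x, deriv φ x • g x = 0) :
    ∃ α : ℂ, ∀ᵐ x, x ∈ I → g x = α := by
  obtain ⟨ψ, hψ, hψ1⟩ := exists_isTest_integral_eq_one hc
  refine ⟨∫ x, ψ x • g x, ?_⟩
  set α := ∫ x, ψ x • g x with hα
  have hg' : LocallyIntegrableOn (fun x => g x - α) (I : Set ℝ) :=
    hg.sub (continuousOn_const.locallyIntegrableOn I.isOpen.measurableSet)
  -- Since ∫ψ = 1, χ - (∫χ)ψ has mean zero and is the derivative of a test function, so ∫χg = (∫χ)α.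
  have key := I.isOpen.ae_eq_zero_of_integral_contDiff_smul_eq_zero hg' fun χ h1 h2 h3 => by
    have hχ : IsTest I χ := ⟨h1, h2, h3⟩
    obtain ⟨Φ, hΦ, hΦ'⟩ := (hχ.sub_const_mul hψ (∫ x, χ x)).exists_deriv_eq hc (by
      rw [integral_sub hχ.integrable (hψ.integrable.const_mul _), integral_const_mul, hψ1]
      ring)
    have h0 := h Φ hΦ
    rw [hΦ'] at h0
    have e2 : ∫ x, χ x • (g x - α) = (∫ x, χ x • g x) - (∫ x, χ x) • α := by
      rw [← integral_smul_const, ← integral_sub (hχ.integrable_smul hg)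
        (hχ.integrable.smul_const α)]
      exact integral_congr_ae (Eventually.of_forall fun x => by simp only [smul_sub])
    rw [e2, hα, ← hχ.integral_sub_const_mul_smul hψ _ hg, h0]
  filter_upwards [key] with x hx hxI
  exact sub_eq_zero.1 (hx hxI)

/-- Du Bois-Reymond's lemma of second order. -/
theorem ae_eq_affine_of_integral_deriv_deriv_smul {c : ℝ} (hc : c ∈ I) {g : ℝ → ℂ}
    (hg : LocallyIntegrableOn g (I : Set ℝ))
    (h : ∀ φ, IsTest I φ → ∫ x, deriv (deriv φ) x • g x = 0) :
    ∃ α β : ℂ, ∀ᵐ x : ℝ, x ∈ I → g x = α + β * x := by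
  obtain ⟨ψ, hψ, hψ1⟩ := exists_isTest_integral_eq_one hc
  -- For Φ' = χ - (∫χ)ψ the hypothesis reads ∫χ'g = (∫χ)γ, and ∫χ = -∫xχ'. Thus g + xγ annihilates
  -- all χ', and the first-order lemma applies.
  set γ := ∫ x, deriv ψ x • g x with hγ
  have hlin : LocallyIntegrableOn (fun x : ℝ => (x : ℂ) * γ) (I : Set ℝ) :=
    (by fun_prop : Continuous fun x : ℝ => (x : ℂ) * γ).locallyIntegrable.locallyIntegrableOn _
  have hg' : LocallyIntegrableOn (fun x => g x + (x : ℂ) * γ) (I : Set ℝ) := hg.add hlin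
  obtain ⟨α, hα⟩ := ae_eq_const_of_integral_deriv_smul hc hg' fun χ hχ => by
    obtain ⟨Φ, hΦ, hΦ'⟩ := (hχ.sub_const_mul hψ (∫ x, χ x)).exists_deriv_eq hc (by
      rw [integral_sub hχ.integrable (hψ.integrable.const_mul _), integral_const_mul, hψ1]
      ring)
    have h0 := h Φ hΦ
    rw [hΦ'] at h0
    have hdd : deriv (fun x => χ x - (∫ x, χ x) * ψ x) =
        fun x => deriv χ x - (∫ x, χ x) * deriv ψ x := funext fun x =>
      ((hχ.differentiable x).hasDerivAt.sub
        ((hψ.differentiable x).hasDerivAt.const_mul _)).deriv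
    rw [hdd] at h0
    have hxd : Integrable (fun x => x * deriv χ x) :=
      (by exact continuous_id.mul hχ.derivative.contDiff.continuous :
        Continuous fun x => x * deriv χ x).integrable_of_hasCompactSupport
        (hχ.derivative.hasCompactSupport.mul_left (f := fun x : ℝ => x))
    have hxc : Integrable (fun x => x * χ x) :=
      (by exact continuous_id.mul hχ.contDiff.continuous :
        Continuous fun x => x * χ x).integrable_of_hasCompactSupport
        (hχ.hasCompactSupport.mul_left (f := fun x : ℝ => x))
    have e2 : ∫ x, x * deriv χ x = -∫ x, χ x := by
      have hd : ∀ x, HasDerivAt (fun x => x * χ x) (χ x + x * deriv χ x) x := fun x => by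
        have := (hasDerivAt_id x).mul (hχ.differentiable x).hasDerivAt
        exact this.congr_deriv (by simp)
      have := integral_eq_zero_of_hasDerivAt_of_integrable hd (hχ.integrable.add hxd) hxc
      rw [integral_add hχ.integrable hxd] at this
      linarith
    have e3 : ∫ x, deriv χ x • (g x + (x : ℂ) * γ) =
        (∫ x, deriv χ x • g x) + (∫ x, x * deriv χ x) • γ := by
      rw [← integral_smul_const, ← integral_add (hχ.derivative.integrable_smul hg)
        (hxd.smul_const γ)]
      refine integral_congr_ae (Eventually.of_forall fun x => ?_)
      simp only [smul_add, Complex.real_smul]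
      push_cast
      ring
    rw [e3, e2, neg_smul, ← sub_eq_add_neg, hγ,
      ← hχ.derivative.integral_sub_const_mul_smul hψ.derivative _ hg, h0]
  refine ⟨α, -γ, ?_⟩
  filter_upwards [hα] with x hx hxI
  rw [← hx hxI]
  ring

end DuBoisReymond

/-- Weak solutions of `u'' = k` are classical (Carathéodory) solutions. -/
theorem exists_isAC2_of_weak {I : Opens ℝ} [hI : (I : Set ℝ).OrdConnected] {c : ℝ} (hc : c ∈ I)
    {g k : ℝ → ℂ} (hg : LocallyIntegrableOn g (I : Set ℝ))
    (hk : ∀ a b, uIcc a b ⊆ (I : Set ℝ) → IntervalIntegrable k volume a b)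
    (h : ∀ φ, IsTest I φ → ∫ x, deriv (deriv φ) x • g x = ∫ x, φ x • k x) :
    ∃ u u₁ : ℝ → ℂ, IsAC2 I u u₁ k ∧ ∀ᵐ x, x ∈ I → g x = u x := by
  have hsub : ∀ {a b}, a ∈ I → b ∈ I → uIcc a b ⊆ (I : Set ℝ) := fun ha hb =>
    hI.uIcc_subset ha hb
  set K₁ : ℝ → ℂ := fun t => ∫ s in c..t, k s with hK₁
  set K : ℝ → ℂ := fun t => ∫ s in c..t, K₁ s with hK
  have heq : ∀ a b, uIcc a b ⊆ (I : Set ℝ) → ∫ x in a..b, k x = K₁ b - K₁ a := fun a b hab =>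
    (intervalIntegral.integral_interval_sub_left (hk _ _ (hsub hc (hab right_mem_uIcc)))
      (hk _ _ (hsub hc (hab left_mem_uIcc)))).symm
  have hcont : ContinuousOn K₁ (I : Set ℝ) := by
    refine LocAC.continuousOn fun a b hab => ?_
    have hconst : AbsolutelyContinuousOnInterval (fun _ : ℝ => K₁ a) a b :=
      (contDiff_const (n := 1)).contDiffOn.absolutelyContinuousOnInterval
    refine ac_congr (fun x hx => ?_)
      ((absolutelyContinuousOnInterval_primitive (hk a b hab) left_mem_uIcc).add hconst)
    have := heq a x ((uIcc_subset_uIcc_left hx).trans hab)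
    simp [this]
  have hKac : IsAC2 I K K₁ k := by
    refine ⟨fun t ht => ?_, hk, heq⟩
    exact intervalIntegral.integral_hasDerivAt_right
      (hcont.mono (hsub hc ht)).intervalIntegrable
      (hcont.stronglyMeasurableAtFilter I.isOpen t ht) (hcont.continuousAt (I.isOpen.mem_nhds ht))
  have hKcont : ContinuousOn K (I : Set ℝ) := hKac.locAC.continuousOn
  have hKloc : LocallyIntegrableOn K (I : Set ℝ) :=
    hKcont.locallyIntegrableOn I.isOpen.measurableSet
  -- `K` is one solution of u'' = k, so `g - K` has vanishing weak second derivative and is affine.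
  obtain ⟨α, β, hαβ⟩ := ae_eq_affine_of_integral_deriv_deriv_smul hc (hg.sub hKloc) fun φ hφ => by
    obtain ⟨a, b, hab, hIcc, hsupp⟩ := exists_subset_Ioo hc hφ.hasCompactSupport hφ.tsupport_subset
    have huIcc : uIcc a b ⊆ (I : Set ℝ) := by rwa [uIcc_of_le hab.le]
    have hz : ∀ x, x ∉ Ioo a b → φ x = 0 ∧ deriv φ x = 0 ∧ deriv (deriv φ) x = 0 := fun x hx => by
      have hx' : x ∉ tsupport φ := fun h => hx (hsupp h)
      have hx1 : x ∉ tsupport (deriv φ) := fun h => hx' (tsupport_deriv_subset (𝕜 := ℝ) h)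
      exact ⟨image_eq_zero_of_notMem_tsupport hx', image_eq_zero_of_notMem_tsupport hx1,
        image_eq_zero_of_notMem_tsupport fun h => hx1 (tsupport_deriv_subset (𝕜 := ℝ) h)⟩
    have hφac : IsAC2 I (fun x => (φ x : ℂ)) (fun x => ((deriv φ x : ℝ) : ℂ))
        (fun x => ((deriv (deriv φ) x : ℝ) : ℂ)) := by
      have h2 : ContDiff ℝ 2 (fun x => (φ x : ℂ)) :=
        contDiff_infty.1 hφ.ofReal_mem_testSpace.1 2
      have d1 : deriv (fun x => (φ x : ℂ)) = fun x => ((deriv φ x : ℝ) : ℂ) :=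
        funext fun x => (hφ.differentiable x).hasDerivAt.ofReal_comp.deriv
      have d2 : deriv (fun x => ((deriv φ x : ℝ) : ℂ)) = fun x => ((deriv (deriv φ) x : ℝ) : ℂ) :=
        funext fun x => (hφ.derivative.differentiable x).hasDerivAt.ofReal_comp.deriv
      have := IsAC2.of_contDiff (I := I) h2
      rwa [d1, d2] at this
    -- The interval contains the support of φ in its interior, so the boundary terms of Lagrange's
    -- identity vanish.
    have hlag := hφac.lagrange hKac huIcc
    have ha := hz a fun h => lt_irrefl _ h.1
    have hb := hz b fun h => lt_irrefl _ h.2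
    rw [ha.1, ha.2.1, hb.1, hb.2.1] at hlag
    have hfull : ∀ (χ : ℝ → ℝ) (w : ℝ → ℂ), (∀ x, x ∉ Ioo a b → χ x = 0) →
        ∫ x, χ x • w x = ∫ x in a..b, (χ x : ℂ) * w x := fun χ w hχ => by
      rw [intervalIntegral.integral_eq_integral_of_support_subset]
      · simp only [Complex.real_smul]
      · intro x hx
        by_contra hx'
        refine hx ?_
        have : x ∉ Ioo a b := fun h => hx' (Ioo_subset_Ioc_self h)
        simp [hχ x this]
    have i1 : IntervalIntegrable (fun x => (φ x : ℂ) * k x) volume a b :=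
      (hk a b huIcc).continuousOn_mul (hφac.locAC.continuousOn.mono huIcc)
    have i2 : IntervalIntegrable (fun x => ((deriv (deriv φ) x : ℝ) : ℂ) * K x) volume a b :=
      ((Complex.continuous_ofReal.comp hφ.derivative.derivative.contDiff.continuous).continuousOn.mul
        (hKcont.mono huIcc)).intervalIntegrable
    rw [intervalIntegral.integral_sub i1 i2, ← hfull _ _ fun x hx => (hz x hx).1,
      ← hfull _ _ fun x hx => (hz x hx).2.2] at hlag
    have hsplit : ∫ x, deriv (deriv φ) x • (g - K) x =
        (∫ x, deriv (deriv φ) x • g x) - ∫ x, deriv (deriv φ) x • K x := by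
      rw [← integral_sub (hφ.derivative.derivative.integrable_smul hg)
        (hφ.derivative.derivative.integrable_smul hKloc)]
      exact integral_congr_ae (Eventually.of_forall fun x => by
        simp only [Pi.sub_apply, smul_sub])
    rw [hsplit, h φ hφ, hlag]
    simp
  have haff : IsAC2 I (fun x : ℝ => α + β * x) (fun _ => β) (fun _ => 0) := by
    refine ⟨fun t _ => ?_, fun a b _ => by simp, fun a b _ => by simp⟩
    simpa using ((Complex.ofRealCLM.hasDerivAt (x := t)).const_mul β).const_add α
  refine ⟨fun x => K x + (α + β * x), fun x => K₁ x + β, ?_, ?_⟩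
  · simpa using hKac.add haff
  · filter_upwards [hαβ] with x hx hxI
    have := hx hxI
    simp only [Pi.sub_apply] at this
    rw [← this]
    ring

end HalfLineOscillator

/-! ### The adjoint of the minimal operator and its boundary map -/

namespace HalfLineOscillator

open ComplexConjugate

variable {I : Opens ℝ}

theorem inner_eq_integral {p q : L2 I} {u v : ℝ → ℂ} (hp : p =ᵐ[volume.restrict (I : Set ℝ)] u)
    (hq : q =ᵐ[volume.restrict (I : Set ℝ)] v) :
    inner ℂ p q = ∫ t in (I : Set ℝ), conj (u t) * v t := by
  rw [L2.inner_def]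
  refine integral_congr_ae ?_
  filter_upwards [hp, hq] with t h1 h2
  rw [h1, h2, RCLike.inner_apply, mul_comm]

theorem oscMin_graph (I : Opens ℝ) :
    (oscMin I).graph = oscGraph I (testSpace I) (testSpace_le I) := oscOp_graph _ _ _

theorem oscMax_graph (I : Opens ℝ) : (oscMax I).graph = oscGraph I (maxSpace I) le_rfl :=
  oscOp_graph _ _ _

theorem oscBC_graph (I : Opens ℝ) (θ : ℝ) :
    (oscBC I θ).graph = oscGraph I (bcSpace I θ) (bcSpace_le I θ) := oscOp_graph _ _ _

/-- Test functions are dense in `L₂(I)`. -/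
theorem dense_oscMin_domain (I : Opens ℝ) : Dense ((oscMin I).domain : Set (L2 I)) := by
  rw [Submodule.dense_iff_topologicalClosure_eq_top, Submodule.topologicalClosure_eq_top_iff,
    Submodule.eq_bot_iff]
  intro g hg
  rw [Submodule.mem_orthogonal] at hg
  have hloc : LocallyIntegrableOn g (I : Set ℝ) (volume.restrict (I : Set ℝ)) :=
    ((Lp.memLp g).locallyIntegrable (by norm_num)).locallyIntegrableOn _
  have key := I.isOpen.ae_eq_zero_of_integral_contDiff_smul_eq_zero hloc fun φ h1 h2 h3 => by
    have hφ : IsTest I φ := ⟨h1, h2, h3⟩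
    obtain ⟨p, hp, hp1, -⟩ := exists_mem_oscMin_graph I _ hφ.ofReal_mem_testSpace
    have := hg p.1 (LinearPMap.mem_domain_of_mem_graph hp)
    rw [inner_eq_integral hp1 (EventuallyEq.refl _ _)] at this
    simpa only [Complex.conj_ofReal, Complex.real_smul] using this
  rw [Lp.eq_zero_iff_ae_eq_zero]
  filter_upwards [key, ae_restrict_mem I.isOpen.measurableSet] with x hx hxI
  simpa using hx hxI

theorem exists_isMaximal_of_mem_graph {D : Submodule ℂ (ℝ → ℂ)} {hD : D ≤ maxSpace I}
    {p : L2 I × L2 I} (hp : p ∈ oscGraph I D hD) :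
    ∃ u ∈ D, p.1 =ᵐ[volume.restrict (I : Set ℝ)] u ∧
      p.2 =ᵐ[volume.restrict (I : Set ℝ)] osc u ∧ IsMaximal I u (deriv u) (osc u) := by
  obtain ⟨u, hu, h1, h2⟩ := hp
  exact ⟨u, hu, h1, h2, IsMaximal.of_mem_maxSpace (hD hu) ((memLp_congr_ae h1).1 (Lp.memLp _))
    ((memLp_congr_ae h2).1 (Lp.memLp _))⟩

theorem oscGraph_mono {D D' : Submodule ℂ (ℝ → ℂ)} {hD : D ≤ maxSpace I} {hD' : D' ≤ maxSpace I}
    (h : D ≤ D') : oscGraph I D hD ≤ oscGraph I D' hD' :=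
  fun _ ⟨u, hu, h1, h2⟩ => ⟨u, h hu, h1, h2⟩

theorem oscOp_mono {D D' : Submodule ℂ (ℝ → ℂ)} {hD : D ≤ maxSpace I} {hD' : D' ≤ maxSpace I}
    (h : D ≤ D') : oscOp I D hD ≤ oscOp I D' hD' := by
  rw [← LinearPMap.le_graph_iff, oscOp_graph, oscOp_graph]
  exact oscGraph_mono h

theorem tendsto_zero_of_mem_testSpace {u : ℝ → ℂ} (hu : u ∈ testSpace I) (h0 : (0 : ℝ) ∉ I) :
    Tendsto u (𝓝[(I : Set ℝ)] 0) (𝓝 0) ∧ Tendsto (deriv u) (𝓝[(I : Set ℝ)] 0) (𝓝 0) := by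
  have h1 : (0 : ℝ) ∉ tsupport u := fun h => h0 (hu.2.2 h)
  have h2 : (0 : ℝ) ∉ tsupport (deriv u) := fun h => h1 (tsupport_deriv_subset (𝕜 := ℝ) h)
  have key : ∀ {w : ℝ → ℂ}, (0 : ℝ) ∉ tsupport w → Tendsto w (𝓝[(I : Set ℝ)] 0) (𝓝 0) :=
    fun hw => tendsto_const_nhds.congr'
      ((notMem_tsupport_iff_eventuallyEq.1 hw).symm.filter_mono nhdsWithin_le_nhds)
  exact ⟨key h1, key h2⟩

theorem zero_notMem (hI : I = posHalfLine ∨ I = negHalfLine) : (0 : ℝ) ∉ I := by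
  rcases hI with rfl | rfl
  · exact lt_irrefl (0 : ℝ)
  · exact lt_irrefl (0 : ℝ)

theorem neBot_nhdsWithin (hI : I = posHalfLine ∨ I = negHalfLine) :
    (𝓝[(I : Set ℝ)] (0 : ℝ)).NeBot := by
  rcases hI with rfl | rfl
  · exact nhdsGT_neBot 0
  · exact nhdsLT_neBot 0

theorem ordConnected_halfLine (hI : I = posHalfLine ∨ I = negHalfLine) :
    (I : Set ℝ).OrdConnected := by
  rcases hI with rfl | rfl
  · exact ordConnected_Ioi
  · exact ordConnected_Iio

theorem exists_mem_halfLine (hI : I = posHalfLine ∨ I = negHalfLine) : ∃ c : ℝ, c ∈ I := by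
  rcases hI with rfl | rfl
  · exact ⟨1, one_pos (α := ℝ)⟩
  · exact ⟨-1, neg_one_lt_zero (R := ℝ)⟩

/-- A weak solution of `𝒜x = y` is in the maximal domain. -/
theorem mem_oscGraph_of_weak [hI : (I : Set ℝ).OrdConnected] {c : ℝ} (hc : c ∈ I) {x y : L2 I}
    (h : ∀ p ∈ (oscMin I).graph, inner ℂ p.2 x = inner ℂ p.1 y) :
    (x, y) ∈ oscGraph I (maxSpace I) le_rfl := by
  set k : ℝ → ℂ := fun t => (t : ℂ) ^ 2 * x t - 2 * y t with hk
  have hx : MemLp x 2 (volume.restrict (I : Set ℝ)) := Lp.memLp x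
  have hy : MemLp y 2 (volume.restrict (I : Set ℝ)) := Lp.memLp y
  have hloc : ∀ {w : ℝ → ℂ}, MemLp w 2 (volume.restrict (I : Set ℝ)) →
      LocallyIntegrableOn w (I : Set ℝ) := fun hw t ht => by
    obtain ⟨s, hs, hs'⟩ := (hw.locallyIntegrable (by norm_num)) t
    refine ⟨s ∩ I, inter_mem (mem_nhdsWithin_of_mem_nhds hs) self_mem_nhdsWithin, ?_⟩
    rw [IntegrableOn, Measure.restrict_restrict' I.isOpen.measurableSet] at hs'
    exact hs'
  -- Testing against real φ removes the conjugation; multiplying the tested equation 𝒜x = y by -2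
  -- puts it in the form x'' = t²x - 2y.
  obtain ⟨u, u₁, hu, hxu⟩ := exists_isAC2_of_weak hc (hloc hx)
    (fun a b hab => intervalIntegrable_of_memLp hx hy hab) (k := k) fun φ hφ => by
      obtain ⟨p, hp, hp1, hp2⟩ := exists_mem_oscMin_graph I _ hφ.ofReal_mem_testSpace
      have hφp := h p hp
      rw [inner_eq_integral hp2 (EventuallyEq.refl _ _),
        inner_eq_integral hp1 (EventuallyEq.refl _ _)] at hφp
      have d1 : deriv (fun x => (φ x : ℂ)) = fun x => ((deriv φ x : ℝ) : ℂ) :=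
        funext fun x => (hφ.differentiable x).hasDerivAt.ofReal_comp.deriv
      have d2 : deriv (fun x => ((deriv φ x : ℝ) : ℂ)) = fun x => ((deriv (deriv φ) x : ℝ) : ℂ) :=
        funext fun x => (hφ.derivative.differentiable x).hasDerivAt.ofReal_comp.deriv
      have hfull : ∀ (χ : ℝ → ℝ) (w : ℝ → ℂ), IsTest I χ →
          ∫ t in (I : Set ℝ), χ t • w t = ∫ t, χ t • w t := fun χ w hχ =>
        setIntegral_eq_integral_of_forall_compl_eq_zero fun t ht => by
          rw [hχ.eq_zero_of_notMem ht, zero_smul]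
      have hsq : IsTest I (fun t => t ^ 2 * φ t) := by
        refine ⟨(contDiff_id.pow 2).mul hφ.contDiff,
          hφ.hasCompactSupport.mul_left (f := fun t : ℝ => t ^ 2), ?_⟩
        exact (tsupport_smul_subset_right (fun t : ℝ => t ^ 2) φ).trans hφ.tsupport_subset
      have i1 := hφ.derivative.derivative.integrable_smul (hloc hx)
      have i2 := hsq.integrable_smul (hloc hx)
      have i3 := hφ.integrable_smul (hloc hy)
      have e1 : ∫ t in (I : Set ℝ), conj (osc (fun t => (φ t : ℂ)) t) * x t =
          -(1 / 2) * (∫ t, deriv (deriv φ) t • x t) +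
            (1 / 2) * ∫ t, (t ^ 2 * φ t) • x t := by
        rw [← hfull _ _ hφ.derivative.derivative, ← hfull _ _ hsq, ← integral_const_mul,
          ← integral_const_mul, ← integral_add (i1.integrableOn.const_mul _)
          (i2.integrableOn.const_mul _)]
        refine integral_congr_ae (Eventually.of_forall fun t => ?_)
        simp only [osc, d1, d2, Complex.real_smul, map_add, map_mul, map_neg, map_div₀, map_one,
          map_ofNat, map_pow, Complex.conj_ofReal]
        push_cast
        ring
      have e2 : ∫ t in (I : Set ℝ), conj ((φ t : ℂ)) * y t = ∫ t, φ t • y t := by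
        rw [← hfull _ _ hφ]
        simp only [Complex.conj_ofReal, Complex.real_smul]
      have e3 : ∫ t, φ t • k t = (∫ t, (t ^ 2 * φ t) • x t) - 2 * ∫ t, φ t • y t := by
        rw [← integral_const_mul, ← integral_sub i2 (i3.const_mul 2)]
        refine integral_congr_ae (Eventually.of_forall fun t => ?_)
        simp only [hk, Complex.real_smul]
        push_cast
        ring
      rw [e1, e2] at hφp
      rw [e3]
      linear_combination -2 * hφp
  have hxu' : x =ᵐ[volume.restrict (I : Set ℝ)] u :=
    (ae_restrict_iff' I.isOpen.measurableSet).2 hxu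
  refine ⟨u, hu.mem_maxSpace, hxu', ?_⟩
  filter_upwards [hu.osc_ae_eq, hxu'] with t h1 h2
  rw [h1, hk, ← h2]
  ring

/-- Membership in the adjoint graph is the weak form of 𝒜x = y. Conversely, Green's identity against
a test function has no boundary term, since test functions vanish near 0. -/
theorem adjoint_oscMin (hI : I = posHalfLine ∨ I = negHalfLine) :
    (oscMin I).adjoint = oscMax I := by
  refine LinearPMap.eq_of_eq_graph ?_
  rw [LinearPMap.adjoint_graph_eq_graph_adjoint (dense_oscMin_domain I), oscMax_graph]
  ext ⟨x, y⟩
  rw [Submodule.mem_adjoint_iff]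
  constructor
  · intro h
    have := ordConnected_halfLine hI
    obtain ⟨c, hc⟩ := exists_mem_halfLine hI
    exact mem_oscGraph_of_weak hc fun p hp => sub_eq_zero.1 (h p.1 p.2 hp)
  · intro h a b hab
    rw [oscMin_graph] at hab
    obtain ⟨φ, hφ, h1, h2, h3⟩ := exists_isMaximal_of_mem_graph hab
    obtain ⟨u, hu, h4, h5, h6⟩ := exists_isMaximal_of_mem_graph h
    obtain ⟨k, hk, hgreen⟩ := green hI
    obtain ⟨t1, t2⟩ := tendsto_zero_of_mem_testSpace hφ (zero_notMem hI)
    obtain ⟨c, d, t3, t4⟩ := exists_boundary_values hI h6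
    have := hgreen h3.conjugate h6 t1.star t2.star t3 t4
    rw [inner_eq_integral h2 h4, inner_eq_integral h1 h5, ← integral_sub, this]
    · simp
    · exact integrable_mul_of_memLp h3.conjugate.memLp_osc h6.memLp
    · exact integrable_mul_of_memLp h3.conjugate.memLp h6.memLp_osc

/-- The pair `q` consists of the boundary values at `0` of the function `x` in the maximal
domain. -/
def HasBoundaryValues (I : Opens ℝ) (x : L2 I) (q : ℂ × ℂ) : Prop :=
  ∃ u ∈ maxSpace I, x =ᵐ[volume.restrict (I : Set ℝ)] u ∧
    Tendsto u (𝓝[(I : Set ℝ)] 0) (𝓝 q.1) ∧ Tendsto (deriv u) (𝓝[(I : Set ℝ)] 0) (𝓝 q.2)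

namespace HasBoundaryValues

variable {x y : L2 I} {q r : ℂ × ℂ}

theorem add (hx : HasBoundaryValues I x q) (hy : HasBoundaryValues I y r) :
    HasBoundaryValues I (x + y) (q + r) := by
  obtain ⟨u, hu, h1, h2, h3⟩ := hx
  obtain ⟨v, hv, h4, h5, h6⟩ := hy
  exact ⟨u + v, add_mem hu hv, (Lp.coeFn_add x y).trans (h1.add h4), h2.add h5,
    (h3.add h6).congr' (eventually_of_mem self_mem_nhdsWithin (eqOn_deriv_add hu.2.1 hv.2.1))⟩

theorem smul (c : ℂ) (hx : HasBoundaryValues I x q) : HasBoundaryValues I (c • x) (c • q) := by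
  obtain ⟨u, hu, h1, h2, h3⟩ := hx
  exact ⟨c • u, Submodule.smul_mem _ c hu, (Lp.coeFn_smul c x).trans (h1.const_smul c),
    h2.const_smul c, (h3.const_smul c).congr'
      (eventually_of_mem self_mem_nhdsWithin (eqOn_deriv_smul c hu.2.1))⟩

/-- Continuous functions equal almost everywhere on an open set agree there; boundary values thus
depend only on the L₂ class. -/
theorem eqOn_of_ae_eq {u v : ℝ → ℂ} (hu : u ∈ maxSpace I) (hv : v ∈ maxSpace I)
    (h1 : x =ᵐ[volume.restrict (I : Set ℝ)] u) (h2 : x =ᵐ[volume.restrict (I : Set ℝ)] v) :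
    EqOn u v (I : Set ℝ) ∧ EqOn (deriv u) (deriv v) (I : Set ℝ) := by
  have h : EqOn u v (I : Set ℝ) := Measure.eqOn_open_of_ae_eq (h1.symm.trans h2) I.isOpen
    hu.1.continuousOn hv.1.continuousOn
  exact ⟨h, fun t ht => (h.eventuallyEq_of_mem (I.isOpen.mem_nhds ht)).deriv_eq⟩

theorem tendsto (hx : HasBoundaryValues I x q) {v : ℝ → ℂ} (hv : v ∈ maxSpace I)
    (h : x =ᵐ[volume.restrict (I : Set ℝ)] v) :
    Tendsto v (𝓝[(I : Set ℝ)] 0) (𝓝 q.1) ∧ Tendsto (deriv v) (𝓝[(I : Set ℝ)] 0) (𝓝 q.2) := by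
  obtain ⟨u, hu, h1, h2, h3⟩ := hx
  obtain ⟨e1, e2⟩ := eqOn_of_ae_eq hu hv h1 h
  exact ⟨h2.congr' (eventually_of_mem self_mem_nhdsWithin e1),
    h3.congr' (eventually_of_mem self_mem_nhdsWithin e2)⟩

theorem unique (hI : I = posHalfLine ∨ I = negHalfLine) (hx : HasBoundaryValues I x q)
    (hy : HasBoundaryValues I x r) : q = r := by
  have := neBot_nhdsWithin hI
  obtain ⟨u, hu, h1, h2, h3⟩ := hy
  obtain ⟨h4, h5⟩ := hx.tendsto hu h1
  exact Prod.ext (tendsto_nhds_unique h4 h2) (tendsto_nhds_unique h5 h3)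

end HasBoundaryValues

theorem exists_isMaximal_adjoint (hI : I = posHalfLine ∨ I = negHalfLine)
    (x : (oscMin I).adjoint.domain) : ∃ u ∈ maxSpace I,
      (x : L2 I) =ᵐ[volume.restrict (I : Set ℝ)] u ∧
      (oscMin I).adjoint x =ᵐ[volume.restrict (I : Set ℝ)] osc u ∧
      IsMaximal I u (deriv u) (osc u) := by
  have := (oscMin I).adjoint.mem_graph x
  have hg : (oscMin I).adjoint.graph = oscGraph I (maxSpace I) le_rfl := by
    rw [adjoint_oscMin hI, oscMax_graph]
  rw [hg] at this
  exact exists_isMaximal_of_mem_graph this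

theorem exists_hasBoundaryValues (hI : I = posHalfLine ∨ I = negHalfLine)
    (x : (oscMin I).adjoint.domain) : ∃ q, HasBoundaryValues I x q := by
  obtain ⟨u, hu, h1, -, h3⟩ := exists_isMaximal_adjoint hI x
  obtain ⟨a, b, ha, hb⟩ := exists_boundary_values hI h3
  exact ⟨(a, b), u, hu, h1, ha, hb⟩

/-- There are functions in the maximal domain with arbitrary boundary values at `0`. -/
theorem exists_mem_oscMax_of_boundary_values (I : Opens ℝ) (q : ℂ × ℂ) :
    ∃ x ∈ (oscMax I).domain, HasBoundaryValues I x q := by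
  let χ : ContDiffBump (0 : ℝ) := ⟨1, 2, one_pos, one_lt_two⟩
  set u : ℝ → ℂ := fun t => (q.1 + q.2 * t) * (χ t : ℂ) with hu
  have hχ : ContDiff ℝ ∞ (fun t => (χ t : ℂ)) := Complex.ofRealCLM.contDiff.comp χ.contDiff
  have hlin : ContDiff ℝ ∞ (fun t : ℝ => q.1 + q.2 * (t : ℂ)) :=
    contDiff_const.add (contDiff_const.mul Complex.ofRealCLM.contDiff)
  have hus : ContDiff ℝ ∞ u := hlin.mul hχ
  have huc : HasCompactSupport u :=
    (χ.hasCompactSupport.comp_left (g := fun x : ℝ => (x : ℂ)) Complex.ofReal_zero).mul_left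
  -- The support of `u` may contain 0, so `u` is treated as a test function on the whole line and
  -- its square integrability is then restricted to `I`.
  have hmem : u ∈ testSpace (⊤ : Opens ℝ) := ⟨hus, huc, subset_univ _⟩
  have hmax : u ∈ maxSpace I := by
    obtain ⟨h1, h2, h3⟩ := testSpace_le _ hmem
    exact ⟨fun a b _ => h1 a b (subset_univ _), fun t _ => h2 t trivial,
      fun a b _ => h3 a b (subset_univ _)⟩
  obtain ⟨p, -, hp1, hp2⟩ := exists_mem_oscMin_graph ⊤ u hmem
  have hres : volume.restrict (I : Set ℝ) ≤ volume.restrict ((⊤ : Opens ℝ) : Set ℝ) :=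
    Measure.restrict_mono (subset_univ _) le_rfl
  have hu2 : MemLp u 2 (volume.restrict (I : Set ℝ)) :=
    ((memLp_congr_ae hp1).1 (Lp.memLp p.1)).mono_measure hres
  have ho2 : MemLp (osc u) 2 (volume.restrict (I : Set ℝ)) :=
    ((memLp_congr_ae hp2).1 (Lp.memLp p.2)).mono_measure hres
  have hnear : u =ᶠ[𝓝 0] fun t : ℝ => q.1 + q.2 * (t : ℂ) := by
    filter_upwards [χ.eventuallyEq_one] with t ht
    simp only [hu, ht, Pi.one_apply, Complex.ofReal_one, mul_one]
  have hderiv : HasDerivAt (fun t : ℝ => q.1 + q.2 * (t : ℂ)) q.2 0 := by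
    simpa using ((Complex.ofRealCLM.hasDerivAt (x := 0)).const_mul q.2).const_add q.1
  have h0 : u 0 = q.1 := by simpa using hnear.self_of_nhds
  have h1 : deriv u 0 = q.2 := by rw [hnear.deriv_eq, hderiv.deriv]
  refine ⟨hu2.toLp u, LinearPMap.mem_domain_of_mem_graph (y := ho2.toLp (osc u)) ?_,
    u, hmax, hu2.coeFn_toLp, ?_, ?_⟩
  · rw [oscMax_graph]
    exact ⟨u, hmax, hu2.coeFn_toLp, ho2.coeFn_toLp⟩
  · rw [← h0]
    exact hus.continuous.continuousAt.tendsto.mono_left nhdsWithin_le_nhds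
  · rw [← h1]
    exact (contDiff_infty_iff_deriv.1 hus).2.continuous.continuousAt.tendsto.mono_left
      nhdsWithin_le_nhds

/-- The boundary values at `0` as a linear map on the maximal domain. -/
noncomputable def boundaryMap (hI : I = posHalfLine ∨ I = negHalfLine) :
    (oscMin I).adjoint.domain →ₗ[ℂ] ℂ × ℂ where
  toFun x := (exists_hasBoundaryValues hI x).choose
  map_add' x y := (exists_hasBoundaryValues hI (x + y)).choose_spec.unique hI
    ((exists_hasBoundaryValues hI x).choose_spec.add (exists_hasBoundaryValues hI y).choose_spec)
  map_smul' c x := (exists_hasBoundaryValues hI (c • x)).choose_spec.unique hI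
    ((exists_hasBoundaryValues hI x).choose_spec.smul c)

theorem hasBoundaryValues_boundaryMap (hI : I = posHalfLine ∨ I = negHalfLine)
    (x : (oscMin I).adjoint.domain) : HasBoundaryValues I x (boundaryMap hI x) :=
  (exists_hasBoundaryValues hI x).choose_spec

theorem exists_isBoundaryMap (hI : I = posHalfLine ∨ I = negHalfLine) :
    ∃ k, IsBoundaryMap (oscMin I) (boundaryMap hI) k := by
  obtain ⟨k, hk, hgreen⟩ := green hI
  refine ⟨k, dense_oscMin_domain I, ?_, fun q => ?_, hk, fun x y => ?_⟩
  · rw [adjoint_oscMin hI]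
    exact oscOp_mono (testSpace_le I)
  · obtain ⟨x, hx, hq⟩ := exists_mem_oscMax_of_boundary_values I q
    rw [← adjoint_oscMin hI] at hx
    exact ⟨⟨x, hx⟩, (hasBoundaryValues_boundaryMap hI ⟨x, hx⟩).unique hI hq⟩
  · obtain ⟨u, hu, h1, h2, h3⟩ := exists_isMaximal_adjoint hI x
    obtain ⟨v, hv, h4, h5, h6⟩ := exists_isMaximal_adjoint hI y
    obtain ⟨t1, t2⟩ := (hasBoundaryValues_boundaryMap hI x).tendsto hu h1
    obtain ⟨t3, t4⟩ := (hasBoundaryValues_boundaryMap hI y).tendsto hv h4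
    -- The inner product conjugates its first argument, and `𝒜` has real coefficients, so
    -- conjugation preserves the maximal domain.
    have := hgreen h3.conjugate h6 t1.star t2.star t3 t4
    rw [inner_eq_integral h2 h4, inner_eq_integral h1 h5, ← integral_sub, this]
    · rfl
    · exact integrable_mul_of_memLp h3.conjugate.memLp_osc h6.memLp
    · exact integrable_mul_of_memLp h3.conjugate.memLp h6.memLp_osc

/-- The existence of the one-sided limits demanded in `bcSpace` is automatic on the maximal domain,
so only the linear condition on them remains. -/
theorem isRestriction_oscBC (hI : I = posHalfLine ∨ I = negHalfLine) (θ : ℝ) :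
    IsBoundaryMap.IsRestriction (boundaryMap hI) (oscBC I θ) θ := by
  refine ⟨?_, fun x => ⟨fun hx => ?_, fun hx => ?_⟩⟩
  · rw [adjoint_oscMin hI]
    exact oscOp_mono (bcSpace_le I θ)
  · have hg := (oscBC I θ).mem_graph ⟨x, hx⟩
    rw [oscBC_graph] at hg
    obtain ⟨u, ⟨hu, a, b, ha, hb, hab⟩, h1, -⟩ := hg
    have hx' : HasBoundaryValues I x (a, b) := ⟨u, hu, h1, ha, hb⟩
    rw [(hasBoundaryValues_boundaryMap hI x).unique hI hx']
    exact hab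
  · obtain ⟨u, hu, h1, h2, -⟩ := exists_isMaximal_adjoint hI x
    obtain ⟨t1, t2⟩ := (hasBoundaryValues_boundaryMap hI x).tendsto hu h1
    refine LinearPMap.mem_domain_of_mem_graph (y := (oscMin I).adjoint x) ?_
    rw [oscBC_graph]
    exact ⟨u, ⟨hu, _, _, t1, t2, hx⟩, h1, h2⟩

end HalfLineOscillator

open HalfLineOscillator in
theorem lemma2p2 (I : TopologicalSpace.Opens ℝ) (hI : I = posHalfLine ∨ I = negHalfLine) :
    (oscMin I).IsClosable ∧
    (∀ B : L2 I →ₗ.[ℂ] L2 I, oscMin I ≤ B → IsSelfAdjoint B →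
      B ≤ oscMax I ∧
      (oscMin I).closure ≤ B ∧
      Module.finrank ℂ (B.domain ⧸ (oscMin I).closure.domain.submoduleOf B.domain) = 1 ∧
      ∃ θ ∈ Set.Ico (0 : ℝ) Real.pi, B = oscBC I θ) ∧
    (∀ θ ∈ Set.Ico (0 : ℝ) Real.pi, oscMin I ≤ oscBC I θ ∧ IsSelfAdjoint (oscBC I θ)) := by
  obtain ⟨k, hβ⟩ := exists_isBoundaryMap hI
  refine ⟨isClosable_of_le_adjoint hβ.dense hβ.le_adjoint, fun B hB hsa => ?_, fun θ _ =>
    ⟨hβ.le_isRestriction (isRestriction_oscBC hI θ),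
      hβ.isSelfAdjoint_of_isRestriction (isRestriction_oscBC hI θ)⟩⟩
  obtain ⟨θ, hθ, hres⟩ := hβ.isRestriction_of_isSelfAdjoint hB hsa
  refine ⟨?_, closure_le_of_isClosed hsa.isClosed hB, hβ.finrank_quotient_closure hres, θ, hθ,
    hres.eq (isRestriction_oscBC hI θ)⟩
  rw [← adjoint_oscMin hI]
  exact hres.le
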